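/- Let $\mathbb{T}_L=[0,L]/\!\sim$ and let $f,g:\mathbb{R}\to\mathbb{R}$; for a strictly monotone shear flow $U$ on the infinite channel $\mathbb{T}_L\times\mathbb{R}$ (after the change of variables $y\mapsto U(y)$) these are $f=U''\circ U^{-1}$ and $g=U'\circ U^{-1}$, but no relation between $f$ and $g$ is needed. Write $W(t,x,y)=\sum_{n\in\mathbb{Z}}\hat W(t,k,y)e^{ikx}$, $k=2\pi n/L$. The linearized Euler equations in scattering formulation are $$\partial_t\hat W=\frac{if}{k}\hat\Phi,\qquad \Bigl(-1+\bigl(g(\tfrac{\partial_y}{k}-it)\bigr)^2\Bigr)\hat\Phi=\hat W,\qquad t\in\mathbb{R},\ y\in\mathbb{R},\ k\in\tfrac{2\pi}{L}(\mathbb{Z}\setminus\{0\}),$$ while $\hat W(t,0,\cdot)$ (the $x$-average) is conserved. A solution is a family such that each $\hat W(\cdot,k,\cdot)$, $k\neq0$, is differentiable in time with values in $L^2(\mathbb{R})$ and satisfies these equations, with weak derivatives in $y$ and $\hat\Phi(t,k,\cdot)\in H^1(\mathbb{R})$. Norms are $\|u\|_{H^s}^2=\sum_{j\le s}\|\partial_y^ju\|_{L^2}^2$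 and $\|W\|_{H^m_xH^s_y}^2=\sum_k(1+k^2)^m\|\hat W(k,\cdot)\|_{H^s}^2$. **Theorem.** Let $s\in\mathbb{N}_0$ and $c,M,L_0,C>0$. There are $\delta,K>0$, depending only on $s,c,M,L_0,C$, such that the following holds whenever $0<L\le L_0$, $f,g\in W^{s+1,\infty}(\mathbb{R})$, $c<g<c^{-1}$, $\|g\|_{W^{s+1,\infty}}\le M$ and $$L\,\|f\|_{W^{s+1,\infty}}\le\delta .$$ Let $W$ be a solution with initial datum $\omega_0$. 1. For every $m\in\mathbb{Z}$, if $\omega_0\in H^m_xH^s_y(\mathbb{T}_L\times\mathbb{R})$ then for all $t\in\mathbb{R}$ $$\|W(t)\|_{H^m_xH^s_y(\mathbb{T}_L\times\mathbb{R})}\le K\,\|\omega_0\|_{H^m_xH^s_y(\mathbb{T}_L\times\mathbb{R})}.$$ 2. For every $k\in\frac{2\pi}{L}(\mathbb{Z}\setminus\{0\})$ with $\hat\omega_0(k,\cdot)\in H^s(\mathbb{R})$, the energy $$E_s(t)=\sum_{j\le s}\bigl\langle\partial_y^j\hat W,A(t)\,\partial_y^j\hat W\bigr\rangle_{L^2(\mathbb{R})},$$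 where $A(t)$ is the Fourier multiplier in $y$ with symbol $\exp\bigl(C\arctan(\tfrac{\eta}{k}-t)\bigr)$, is non-increasing in $t\in\mathbb{R}$, and $$\|\hat W(t,k,\cdot)\|_{H^s}^2\le K\,E_s(t)\quad(t\in\mathbb{R}),\qquad E_s(0)\le K\,\|\hat\omega_0(k,\cdot)\|_{H^s}^2 .$$ -/

import Mathlib

open MeasureTheory
open scoped ENNReal FourierTransform

/-- `v` is the weak (distributional) derivative of `u` on the real line. -/
def HasWeakDeriv {E : Type*} [NormedAddCommGroup E] [NormedSpace ℝ E] (u v : ℝ → E) : Prop :=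
  LocallyIntegrable u volume ∧ LocallyIntegrable v volume ∧
    ∀ φ : ℝ → ℝ, ContDiff ℝ (⊤ : ℕ∞) φ → HasCompactSupport φ →
      ∫ y, deriv φ y • u y = -∫ y, φ y • v y

/-- `v 0, …, v N` are the weak derivatives of order `0, …, N` of `f`. -/
def IsWeakDerivChain (N : ℕ) (f : ℝ → ℝ) (v : ℕ → ℝ → ℝ) : Prop :=
  v 0 = f ∧ (∀ j ≤ N, AEStronglyMeasurable (v j) volume) ∧
    ∀ j < N, HasWeakDeriv (v j) (v (j + 1))

/-- The norm of `W^{N,∞}(ℝ)`, the sum of the `L^∞` norms of the weak derivatives of order at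
most `N`. Weak derivatives are unique almost everywhere, so that the infimum is over one single
value; it is `∞` when `f` is not in `W^{N,∞}(ℝ)`. -/
noncomputable def sobolevInfNorm (N : ℕ) (f : ℝ → ℝ) : ℝ≥0∞ :=
  ⨅ (v : ℕ → ℝ → ℝ) (_ : IsWeakDerivChain N f v),
    ∑ j ∈ Finset.range (N + 1), eLpNorm (v j) ∞ volume

/-- Complex valued square integrable functions of `y ∈ ℝ`. -/
abbrev L2R : Type := Lp ℂ 2 (volume : Measure ℝ)

/-- The frequencies `k = 2πn/L` of the torus `T_L = [0,L]/∼`. -/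
noncomputable def torusFreq (L : ℝ) (n : ℤ) : ℝ := 2 * Real.pi * n / L

/-- The squared norm of `H^s(ℝ)`, that is `∑_{j ≤ s} ‖∂_y^j u‖²_{L²}`, written on the Fourier side
(`∂_y` is multiplication by `2πiξ` in the normalization `e^{-2πiyξ}` of the Fourier transform);
it is `∞` when `u` is not in `H^s(ℝ)`. -/
noncomputable def hsNormSq (s : ℕ) (u : L2R) : ℝ≥0∞ :=
  ∑ j ∈ Finset.range (s + 1),
    ∫⁻ ξ : ℝ, ENNReal.ofReal ((2 * Real.pi * ξ) ^ (2 * j)) * ‖(𝓕 u : L2R) ξ‖ₑ ^ 2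

/-- The norm of `H^m_x H^s_y(T_L × ℝ)`. A function (for `m < 0`: distribution) of
`(x, y) ∈ T_L × ℝ` is given by its Fourier coefficients `w n = w n (y)` in `x`, that is
`∑ₙ w n (y) e^{i k x}` with `k = 2πn/L`. The value is `∞` outside of the space. -/
noncomputable def hmhsNorm (L : ℝ) (m : ℤ) (s : ℕ) (w : ℤ → L2R) : ℝ≥0∞ :=
  (∑' n : ℤ, ENNReal.ofReal ((1 + torusFreq L n ^ 2) ^ m) * hsNormSq s (w n)) ^ (1 / 2 : ℝ)

/-- `Φ` is the stream function of `w` at the frequency `k` and time `t`: it is in `H¹(ℝ)` and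
`(-1 + (g (∂_y / k - i t))²) Φ = w`. Here `Φ'` is the weak derivative of `Φ`,
`u = g (∂_y / k - i t) Φ` and `u'` is the weak derivative of `u`. -/
def IsStreamFunction (g : ℝ → ℝ) (k t : ℝ) (w Φ : L2R) : Prop :=
  ∃ Φ' u u' : L2R,
    HasWeakDeriv (Φ : ℝ → ℂ) Φ' ∧
    (∀ᵐ y : ℝ, u y = g y * (Φ' y / k - Complex.I * t * Φ y)) ∧
    HasWeakDeriv (u : ℝ → ℂ) u' ∧
    ∀ᵐ y : ℝ, -Φ y + g y * (u' y / k - Complex.I * t * u y) = w y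

/-- `W` solves the linearized Euler equations in scattering formulation on `T_L × ℝ`:
for every frequency `k ≠ 0`, the Fourier coefficient in `x` is a differentiable function of time
with values in `L²(ℝ)` and `∂ₜ W = (i f / k) Φ`, with the stream function `Φ` of `W` at time `t`.
The coefficient at `k = 0`, the average in `x`, is conserved. -/
def IsScatteringSolution (L : ℝ) (f g : ℝ → ℝ) (W : ℝ → ℤ → L2R) : Prop :=
  (∀ t, W t 0 = W 0 0) ∧
  ∀ n : ℤ, n ≠ 0 → ∀ t : ℝ, ∃ Φ V : L2R,
    IsStreamFunction g (torusFreq L n) t (W t n) Φ ∧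
    (∀ᵐ y : ℝ, V y = Complex.I * f y / torusFreq L n * Φ y) ∧
    HasDerivAt (fun τ => W τ n) V t

/-- The weighted energy `∑_{j ≤ s} ⟨∂_y^j u, A(t) ∂_y^j u⟩`, where `A(t)` is the Fourier multiplier
`exp (C arctan (η / k - t))` and `η = 2πξ`. -/
noncomputable def weightedEnergy (s : ℕ) (C k t : ℝ) (u : L2R) : ℝ≥0∞ :=
  ∑ j ∈ Finset.range (s + 1),
    ∫⁻ ξ : ℝ, ENNReal.ofReal ((2 * Real.pi * ξ) ^ (2 * j) *
      Real.exp (C * Real.arctan (2 * Real.pi * ξ / k - t))) * ‖(𝓕 u : L2R) ξ‖ₑ ^ 2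

/-!
The statement reduces to a bound for a single frequency `k ≠ 0`, uniform in `k`.

**The stream function as a bounded operator.** Write `D = ∂_y / k - i t`. On the Fourier side `D` is
multiplication by `i x` with `x = η / k - t`, and `Λ = (1 - D²)^{-1/2}`, `R = D Λ` are bounded
multipliers with `Λ² - R² = 1`. Divided by `g`, the equation `(-1 + (g D)²) Φ = w` becomes
`T Ψ = -Λ (w / g)` for `Φ = Λ Ψ` and `T = Λ g⁻¹ Λ - R g R`. As `R` is skew-adjoint and
`‖Λ v‖² + ‖R v‖² = ‖v‖²`, the operator `T` is coercive, hence invertible (`isUnit_ellOp`), and the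
evolution is the linear equation `∂ₜ w = B(t) w` with the bounded generator
`B = -(i / k) f Λ T⁻¹ Λ g⁻¹` (`genOp`, `fourier_eq_genOp`), which is continuous in time.

**Gaining two factors `Λ`.** Multiplication by `f ∈ W^{1,∞}` preserves the domain of `D`, and
multiplication by `g` is bounded below in the norm `‖Λ u‖`; the latter follows by testing with
`(N² - D²)^{-1} u`, where for large `N` the commutator of `g` with `D` is negligible. Together,
`|⟨p, B w⟩| ≤ const · ‖f‖ / |k| · ‖Λ p‖ ‖Λ w‖` (`norm_inner_genOp_le`). On the other hand the weight
`a = exp (C arctan x)` satisfies `∂ₜ a = -C a / (1 + x²)`, so that its contribution to the derivative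
of the energy is comparable to `-C ‖Λ w‖²`, and dominates when `L ‖f‖` is small. The weight with
`-C` in place of `C` gives a non-decreasing energy, which controls negative times.

**Derivatives in `y`.** All of this uses only that the coefficients act as bounded operators obeying
the product rule (`IsMulPair`), and that `g` is coercive. Hence it is carried out verbatim in the
Hilbert space `H^s` with the norm `∑_{j ≤ s} ‖(ε ∂)^j u‖²`: there multiplication by `g` is still
coercive when `ε` is small, since every derivative which falls on `g` costs a factor `ε`
(`BddChain.re_inner_sobMul_ge`). No commutator of `∂^j` with the elliptic problem is needed. The
space is represented by `L²` through `v = p û`, with `p` the Fourier weight of the norm.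

**Regularity of the solution.** A solution is only assumed to be in `L²`. The equation in `H^s` is
solvable on time intervals of a fixed length, and by uniqueness in `L²` its solution is the given
one (`exists_lift_of_linear_ode`). So the given solution is a differentiable curve in `H^s`, along
which the energy can be differentiated.
-/

/-! ### Multiplication operators on `L²(ℝ)` -/

/-- Multiplication by `m` as a bounded operator of `L²(ℝ)`; it is `0` by convention when `m` is not
essentially bounded. -/
noncomputable def mulOp (m : ℝ → ℂ) : L2R →L[ℂ] L2R :=
  open Classical in
  if h : MemLp m ∞ (volume : Measure ℝ) then
    LinearMap.mkContinuous
      { toFun := fun u => (h.toLp m • u : L2R)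
        map_add' := Lp.add_smul _
        map_smul' := fun a u => (Lp.smul_comm a _ _).symm } ‖h.toLp m‖
      fun _ => Lp.norm_smul_le _ _
  else 0

theorem coeFn_mulOp {m : ℝ → ℂ} (h : MemLp m ∞ (volume : Measure ℝ)) (u : L2R) :
    ∀ᵐ x, mulOp m u x = m x * u x := by
  have h1 : mulOp m u = (h.toLp m • u : L2R) := by
    rw [mulOp, dif_pos h]
    rfl
  rw [h1]
  filter_upwards [Lp.coeFn_lpSMul (h.toLp m) u (r := 2), h.coeFn_toLp] with x hx hx2
  rw [hx, Pi.smul_apply', hx2, smul_eq_mul]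

theorem norm_mulOp_apply_le {m : ℝ → ℂ} (h : MemLp m ∞ (volume : Measure ℝ)) {b : ℝ}
    (hb : ∀ᵐ x, ‖m x‖ ≤ b) (u : L2R) : ‖mulOp m u‖ ≤ b * ‖u‖ := by
  refine Lp.norm_le_mul_norm_of_ae_le_mul ?_
  filter_upwards [coeFn_mulOp h u, hb] with x hx hbx
  rw [hx, norm_mul]
  gcongr

theorem norm_mulOp_le {m : ℝ → ℂ} (h : MemLp m ∞ (volume : Measure ℝ)) {b : ℝ}
    (hb : ∀ᵐ x, ‖m x‖ ≤ b) : ‖mulOp m‖ ≤ b := by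
  have hb0 : 0 ≤ b := by
    obtain ⟨x, hx⟩ := hb.exists
    exact (norm_nonneg _).trans hx
  exact ContinuousLinearMap.opNorm_le_bound _ hb0 (norm_mulOp_apply_le h hb)

theorem mulOp_mulOp {m n : ℝ → ℂ} (hm : MemLp m ∞ (volume : Measure ℝ))
    (hn : MemLp n ∞ (volume : Measure ℝ)) (u : L2R) :
    mulOp m (mulOp n u) = mulOp (fun x => m x * n x) u := by
  have hmn : MemLp (fun x => m x * n x) ∞ (volume : Measure ℝ) := hn.mul hm
  refine Lp.ext ?_
  filter_upwards [coeFn_mulOp hm (mulOp n u), coeFn_mulOp hn u, coeFn_mulOp hmn u] with x h1 h2 h3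
  rw [h1, h2, h3, mul_assoc]

theorem mulOp_comm {m n : ℝ → ℂ} (hm : MemLp m ∞ (volume : Measure ℝ))
    (hn : MemLp n ∞ (volume : Measure ℝ)) (u : L2R) :
    mulOp m (mulOp n u) = mulOp n (mulOp m u) := by
  rw [mulOp_mulOp hm hn, mulOp_mulOp hn hm]
  simp only [mul_comm]

theorem mulOp_add {m n : ℝ → ℂ} (hm : MemLp m ∞ (volume : Measure ℝ))
    (hn : MemLp n ∞ (volume : Measure ℝ)) :
    mulOp (fun x => m x + n x) = mulOp m + mulOp n := by
  ext1 u
  have hmn : MemLp (fun x => m x + n x) ∞ (volume : Measure ℝ) := hm.add hn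
  refine Lp.ext ?_
  filter_upwards [coeFn_mulOp hm u, coeFn_mulOp hn u, coeFn_mulOp hmn u,
    Lp.coeFn_add (mulOp m u) (mulOp n u)] with x h1 h2 h3 h4
  rw [add_apply, h4, Pi.add_apply, h1, h2, h3, add_mul]

theorem mulOp_const_mul {m : ℝ → ℂ} (hm : MemLp m ∞ (volume : Measure ℝ)) (a : ℂ) :
    mulOp (fun x => a * m x) = a • mulOp m := by
  ext1 u
  refine Lp.ext ?_
  filter_upwards [coeFn_mulOp hm u, coeFn_mulOp (hm.const_mul a) u,
    Lp.coeFn_smul a (mulOp m u)] with x h1 h2 h3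
  rw [smul_apply, h3, Pi.smul_apply, h1, h2, smul_eq_mul, mul_assoc]

theorem mulOp_sub {m n : ℝ → ℂ} (hm : MemLp m ∞ (volume : Measure ℝ))
    (hn : MemLp n ∞ (volume : Measure ℝ)) :
    mulOp (fun x => m x - n x) = mulOp m - mulOp n := by
  have := mulOp_add hm (hn.const_mul (-1))
  rw [mulOp_const_mul hn] at this
  simpa [sub_eq_add_neg] using this

theorem mulOp_one : mulOp (fun _ => 1) = ContinuousLinearMap.id ℂ L2R := by
  ext1 u
  refine Lp.ext ?_
  filter_upwards [coeFn_mulOp (memLp_top_const (1 : ℂ)) u] with x h1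
  rw [h1, one_mul, ContinuousLinearMap.id_apply]

open scoped InnerProductSpace ComplexConjugate in
theorem inner_mulOp_left {m : ℝ → ℂ} (hm : MemLp m ∞ (volume : Measure ℝ)) (u v : L2R) :
    ⟪mulOp m u, v⟫_ℂ = ⟪u, mulOp (fun x => conj (m x)) v⟫_ℂ := by
  have hm' : MemLp (fun x => conj (m x)) ∞ (volume : Measure ℝ) := hm.star
  rw [L2.inner_def, L2.inner_def]
  refine integral_congr_ae ?_
  filter_upwards [coeFn_mulOp hm u, coeFn_mulOp hm' v] with x h1 h2
  rw [h1, h2]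
  simp only [RCLike.inner_apply, map_mul]
  ring

open scoped InnerProductSpace in
/-- The quadratic form of a multiplication operator with a real symbol. -/
theorem re_inner_mulOp {m : ℝ → ℝ} (hm : MemLp (fun x => (m x : ℂ)) ∞ (volume : Measure ℝ))
    (u : L2R) :
    Integrable (fun x => m x * ‖u x‖ ^ 2) volume ∧
      (⟪u, mulOp (fun x => (m x : ℂ)) u⟫_ℂ).re = ∫ x, m x * ‖u x‖ ^ 2 := by
  have h0 := L2.integrable_inner (𝕜 := ℂ) u (mulOp (fun x => (m x : ℂ)) u)
  have h1 : (fun x => RCLike.re ⟪u x, mulOp (fun x => (m x : ℂ)) u x⟫_ℂ) =ᵐ[volume]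
      fun x => m x * ‖u x‖ ^ 2 := by
    filter_upwards [coeFn_mulOp hm u] with x hx
    rw [hx]
    simp only [RCLike.inner_apply]
    rw [mul_assoc, RCLike.mul_conj]
    simp only [RCLike.re_to_complex, RCLike.ofReal_eq_complex_ofReal]
    rw [← Complex.ofReal_pow, ← Complex.ofReal_mul, Complex.ofReal_re]
  refine ⟨h0.re.congr h1, ?_⟩
  rw [L2.inner_def, ← integral_congr_ae h1]
  exact (integral_re h0).symm

/-! ### Coercive operators -/

open scoped InnerProductSpace in
/-- The Lax-Milgram lemma for a complex Hilbert space. -/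
theorem isUnit_of_coercive {H : Type*} [NormedAddCommGroup H] [InnerProductSpace ℂ H]
    [CompleteSpace H] (T : H →L[ℂ] H) {a : ℝ} (ha : 0 < a)
    (h : ∀ v, a * ‖v‖ ^ 2 ≤ (⟪v, T v⟫_ℂ).re) : IsUnit T := by
  have hlow : ∀ v, a * ‖v‖ ≤ ‖T v‖ := by
    intro v
    rcases eq_or_ne v 0 with rfl | hv
    · simp
    · have h1 : (⟪v, T v⟫_ℂ).re ≤ ‖v‖ * ‖T v‖ := re_inner_le_norm (𝕜 := ℂ) v (T v)
      have h2 := h v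
      have hv' : 0 < ‖v‖ := norm_pos_iff.2 hv
      nlinarith
  have hanti : AntilipschitzWith (Real.toNNReal a⁻¹) T := by
    refine AddMonoidHomClass.antilipschitz_of_bound T fun v => ?_
    rw [Real.coe_toNNReal _ (by positivity), ← div_eq_inv_mul, le_div_iff₀ ha]
    linarith [hlow v]
  have hker : T.ker = ⊥ := LinearMap.ker_eq_bot.2 hanti.injective
  have hclosed : IsClosed (T.range : Set H) := by
    rw [LinearMap.coe_range]
    exact hanti.isClosed_range T.uniformContinuous
  have hrange : T.range = ⊤ := by
    have := hclosed.completeSpace_coe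
    rw [← Submodule.orthogonal_orthogonal T.range, Submodule.eq_top_iff']
    intro v w hw
    rw [Submodule.mem_orthogonal'] at hw
    have h0 : ⟪w, T w⟫_ℂ = 0 := hw _ ⟨w, rfl⟩
    have h1 := h w
    rw [h0] at h1
    have hw0 : w = 0 := by
      by_contra hne
      have : 0 < ‖w‖ := norm_pos_iff.2 hne
      have : 0 < a * ‖w‖ ^ 2 := by positivity
      simp at h1
      linarith
    simp [hw0]
  exact ContinuousLinearMap.isUnit_iff_bijective.2
    ⟨LinearMap.ker_eq_bot.1 hker, LinearMap.range_eq_top.1 hrange⟩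

/-! ### Weak derivatives and the Fourier transform -/

section

open scoped ContDiff

theorem HasWeakDeriv.integral_deriv_mul {u v : ℝ → ℂ} (h : HasWeakDeriv u v) {ψ : ℝ → ℂ}
    (hψ : ContDiff ℝ ∞ ψ) (hc : HasCompactSupport ψ) :
    ∫ y, deriv ψ y * u y = -∫ y, ψ y * v y := by
  obtain ⟨hu, hv, h⟩ := h
  set a : ℝ → ℝ := fun y => (ψ y).re with ha
  set b : ℝ → ℝ := fun y => (ψ y).im with hb
  have had : ContDiff ℝ ∞ a := Complex.reCLM.contDiff.comp hψ
  have hbd : ContDiff ℝ ∞ b := Complex.imCLM.contDiff.comp hψ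
  have hac : HasCompactSupport a := hc.comp_left (g := Complex.re) rfl
  have hbc : HasCompactSupport b := hc.comp_left (g := Complex.im) rfl
  have hd : ∀ y, HasDerivAt ψ (deriv ψ y) y := fun y =>
    (hψ.differentiable (by simp) y).hasDerivAt
  have hda : ∀ y, deriv a y = (deriv ψ y).re := fun y =>
    (Complex.reCLM.hasFDerivAt.comp_hasDerivAt y (hd y)).deriv
  have hdb : ∀ y, deriv b y = (deriv ψ y).im := fun y =>
    (Complex.imCLM.hasFDerivAt.comp_hasDerivAt y (hd y)).deriv
  have key : ∀ (w : ℝ → ℂ) (φ : ℝ → ℂ) (p q : ℝ → ℝ), LocallyIntegrable w volume →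
      Continuous p → Continuous q → HasCompactSupport p → HasCompactSupport q →
      (∀ y, p y = (φ y).re) → (∀ y, q y = (φ y).im) →
      ∫ y, φ y * w y = (∫ y, p y • w y) + Complex.I * ∫ y, q y • w y := by
    intro w φ p q hw hp hq hpc hqc hpr hqi
    have i1 : Integrable (fun y => p y • w y) volume :=
      hw.integrable_smul_left_of_hasCompactSupport hp hpc
    have i2 : Integrable (fun y => q y • w y) volume :=
      hw.integrable_smul_left_of_hasCompactSupport hq hqc
    rw [← integral_const_mul, ← integral_add i1 (i2.const_mul _)]
    refine integral_congr_ae (Filter.Eventually.of_forall fun y => ?_)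
    simp only [Complex.real_smul, hpr, hqi]
    conv_lhs => rw [← Complex.re_add_im (φ y)]
    ring
  rw [key u (deriv ψ) (deriv a) (deriv b) hu (had.continuous_deriv (by simp))
      (hbd.continuous_deriv (by simp)) hac.deriv hbc.deriv hda hdb,
    key v ψ a b hv had.continuous hbd.continuous hac hbc (fun _ => rfl) (fun _ => rfl),
    h a had hac, h b hbd hbc]
  ring

theorem HasWeakDeriv.ofReal {f f' : ℝ → ℝ} (h : HasWeakDeriv f f') :
    HasWeakDeriv (fun y => (f y : ℂ)) (fun y => (f' y : ℂ)) := by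
  obtain ⟨h1, h2, h3⟩ := h
  refine ⟨fun x => ?_, fun x => ?_, fun φ hφ hc => ?_⟩
  · obtain ⟨s, hs, hi⟩ := h1 x
    exact ⟨s, hs, hi.ofReal⟩
  · obtain ⟨s, hs, hi⟩ := h2 x
    exact ⟨s, hs, hi.ofReal⟩
  · have := congrArg (fun r : ℝ => (r : ℂ)) (h3 φ hφ hc)
    simp only [Complex.ofReal_neg] at this
    have e : ∀ p : ℝ → ℝ, ((∫ y, p y : ℝ) : ℂ) = ∫ y, (p y : ℂ) := fun p => integral_ofReal.symm
    rw [e, e] at this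
    simpa using this

/-- Square integrable weak derivatives may be tested against Schwartz functions. -/
theorem HasWeakDeriv.integral_deriv_schwartz {u v : L2R} (h : HasWeakDeriv (u : ℝ → ℂ) v)
    (ψ : SchwartzMap ℝ ℂ) :
    ∫ y, deriv ψ y * u y = -∫ y, ψ y * v y := by
  -- the cut-offs `χ (r n * y)` tend to `1`, and their derivatives to `0`, as `r n → 0`
  let χ : ContDiffBump (0 : ℝ) := ⟨1, 2, by norm_num, by norm_num⟩
  have hχ : ContDiff ℝ ∞ χ := χ.contDiff
  obtain ⟨B, hB⟩ : ∃ B, ∀ x, ‖deriv χ x‖ ≤ B :=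
    (hχ.continuous_deriv (by simp)).bounded_above_of_compact_support χ.hasCompactSupport.deriv
  let r : ℕ → ℝ := fun n => ((n : ℝ) + 1)⁻¹
  have hr0 : ∀ n, 0 < r n := fun n => by positivity
  have hr1 : ∀ n, r n ≤ 1 := fun n => inv_le_one_of_one_le₀ (by simp)
  have hr : Filter.Tendsto r Filter.atTop (nhds 0) := by
    simpa [r] using tendsto_one_div_add_atTop_nhds_zero_nat (𝕜 := ℝ)
  let X : ℕ → ℝ → ℂ := fun n y => (χ (r n * y) : ℂ)
  let X' : ℕ → ℝ → ℂ := fun n y => ((r n * deriv χ (r n * y) : ℝ) : ℂ)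
  have hXsm : ∀ n, ContDiff ℝ ∞ (X n) := fun n =>
    Complex.ofRealCLM.contDiff.comp (hχ.comp (contDiff_const.mul contDiff_id))
  have hXd : ∀ n y, HasDerivAt (X n) (X' n y) y := by
    intro n y
    have h1 : HasDerivAt (fun y => χ (r n * y)) (r n * deriv χ (r n * y)) y := by
      have h2 : HasDerivAt χ (deriv χ (r n * y)) (r n * y) :=
        (hχ.differentiable (by simp) _).hasDerivAt
      have h3 : HasDerivAt (fun y : ℝ => r n * y) (r n) y := by
        simpa using (hasDerivAt_id y).const_mul (r n)
      simpa [mul_comm, Function.comp_def] using h2.comp y h3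
    exact h1.ofReal_comp
  have hXc : ∀ n, HasCompactSupport (X n) := by
    intro n
    have h1 : HasCompactSupport (fun y => χ (r n * y)) :=
      χ.hasCompactSupport.comp_homeomorph (Homeomorph.mulLeft₀ (r n) (hr0 n).ne')
    exact h1.comp_left (g := fun x : ℝ => (x : ℂ)) (by simp)
  have hψd : ∀ y, HasDerivAt ψ (deriv ψ y) y := fun y => (ψ.differentiable y).hasDerivAt
  have hψ2 : MemLp ψ 2 (volume : Measure ℝ) := ψ.memLp 2 volume
  have hψ'2 : MemLp (deriv ψ) 2 (volume : Measure ℝ) :=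
    (SchwartzMap.derivCLM ℂ ℂ ψ).memLp 2 volume
  have i1 : Integrable (fun y => deriv ψ y * u y) volume := hψ'2.integrable_mul (Lp.memLp u)
  have i2 : Integrable (fun y => ψ y * u y) volume := hψ2.integrable_mul (Lp.memLp u)
  have i3 : Integrable (fun y => ψ y * v y) volume := hψ2.integrable_mul (Lp.memLp v)
  have hX1 : ∀ n y, ‖X n y‖ ≤ 1 := by
    intro n y
    simp only [X, Complex.norm_real, Real.norm_eq_abs, abs_of_nonneg (χ.nonneg' _)]
    exact χ.le_one
  have hX2 : ∀ n y, ‖X' n y‖ ≤ r n * B := by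
    intro n y
    simp only [X', Complex.norm_real, norm_mul, Real.norm_eq_abs (r n), abs_of_pos (hr0 n)]
    gcongr
    exact hB _
  have hXlim : ∀ y, Filter.Tendsto (fun n => X n y) Filter.atTop (nhds 1) := by
    intro y
    have h1 : Filter.Tendsto (fun n => r n * y) Filter.atTop (nhds 0) := by
      simpa using hr.mul_const y
    have h2 : Filter.Tendsto (fun n => χ (r n * y)) Filter.atTop (nhds (χ 0)) :=
      (χ.continuous.tendsto 0).comp h1
    have h3 : χ 0 = 1 := χ.one_of_mem_closedBall (by simp [χ])
    rw [h3] at h2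
    simpa [X, Function.comp_def] using (Complex.continuous_ofReal.tendsto 1).comp h2
  have hX'lim : ∀ y, Filter.Tendsto (fun n => X' n y) Filter.atTop (nhds 0) := by
    intro y
    refine squeeze_zero_norm (hX2 · y) ?_
    simpa using hr.mul_const B
  have B0 : 0 ≤ B := (norm_nonneg _).trans (hB 0)
  have hX'c : ∀ n, Continuous (X' n) := fun n =>
    Complex.continuous_ofReal.comp (continuous_const.mul
      ((hχ.continuous_deriv (by simp)).comp (continuous_const.mul continuous_id)))
  have lim1 : Filter.Tendsto (fun n => ∫ y, (X' n y * ψ y + X n y * deriv ψ y) * u y)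
      Filter.atTop (nhds (∫ y, deriv ψ y * u y)) := by
    refine tendsto_integral_of_dominated_convergence
      (fun y => B * ‖ψ y * u y‖ + ‖deriv ψ y * u y‖) ?_ ((i2.norm.const_mul B).add i1.norm) ?_ ?_
    · intro n
      refine AEStronglyMeasurable.mul ?_ (Lp.aestronglyMeasurable u)
      exact (((hX'c n).mul ψ.continuous).add ((hXsm n).continuous.mul
        (SchwartzMap.derivCLM ℂ ℂ ψ).continuous)).aestronglyMeasurable
    · intro n
      refine Filter.Eventually.of_forall fun y => ?_
      have e1 : ‖X' n y‖ ≤ B := (hX2 n y).trans (mul_le_of_le_one_left B0 (hr1 n))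
      calc ‖(X' n y * ψ y + X n y * deriv ψ y) * u y‖
          = ‖X' n y * (ψ y * u y) + X n y * (deriv ψ y * u y)‖ := by congr 1; ring
        _ ≤ ‖X' n y‖ * ‖ψ y * u y‖ + ‖X n y‖ * ‖deriv ψ y * u y‖ := by
            rw [← norm_mul, ← norm_mul]
            exact norm_add_le _ _
        _ ≤ B * ‖ψ y * u y‖ + 1 * ‖deriv ψ y * u y‖ := by
            gcongr
            exact hX1 n y
        _ = _ := by rw [one_mul]
    · refine Filter.Eventually.of_forall fun y => ?_
      have := (((hX'lim y).mul_const (ψ y)).add ((hXlim y).mul_const (deriv ψ y))).mul_const (u y)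
      simpa using this
  have lim2 : Filter.Tendsto (fun n => ∫ y, (X n y * ψ y) * v y)
      Filter.atTop (nhds (∫ y, ψ y * v y)) := by
    refine tendsto_integral_of_dominated_convergence (fun y => ‖ψ y * v y‖) ?_ i3.norm ?_ ?_
    · intro n
      exact ((hXsm n).continuous.mul ψ.continuous).aestronglyMeasurable.mul
        (Lp.aestronglyMeasurable v)
    · intro n
      refine Filter.Eventually.of_forall fun y => ?_
      rw [mul_assoc, norm_mul]
      exact mul_le_of_le_one_left (norm_nonneg _) (hX1 n y)
    · refine Filter.Eventually.of_forall fun y => ?_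
      simpa using ((hXlim y).mul_const (ψ y)).mul_const (v y)
  refine tendsto_nhds_unique lim1 ?_
  refine lim2.neg.congr fun n => ?_
  have hsm : ContDiff ℝ ∞ (fun y => X n y * ψ y) := (hXsm n).mul (ψ.smooth _)
  rw [← h.integral_deriv_mul hsm (hXc n).mul_right]
  refine integral_congr_ae (Filter.Eventually.of_forall fun y => ?_)
  have := ((hXd n y).mul (hψd y)).deriv
  simp only [Pi.mul_def] at this
  simp only [this]

/-- On the Fourier side, `v` is the derivative of `u`: `v(ξ) = 2πiξ u(ξ)`. -/
def HasFreqDeriv (u v : L2R) : Prop :=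
  ∀ᵐ ξ : ℝ, v ξ = 2 * Real.pi * Complex.I * ξ * u ξ

theorem HasWeakDeriv.hasFreqDeriv {u v : L2R} (h : HasWeakDeriv (u : ℝ → ℂ) v) :
    HasFreqDeriv (𝓕 u) (𝓕 v) := by
  have h1 : LineDeriv.lineDerivOp (1 : ℝ) (u : TemperedDistribution ℝ ℂ)
      = (v : TemperedDistribution ℝ ℂ) := by
    ext ψ
    rw [TemperedDistribution.lineDerivOp_apply_apply, Lp.toTemperedDistribution_apply,
      Lp.toTemperedDistribution_apply]
    have := h.integral_deriv_schwartz ψ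
    simp only [smul_eq_mul]
    rw [← neg_eq_iff_eq_neg.2 this, ← integral_neg]
    refine integral_congr_ae (Filter.Eventually.of_forall fun y => ?_)
    simp [SchwartzMap.lineDerivOp_apply_eq_fderiv]
  have h2 := TemperedDistribution.fourier_lineDerivOp_eq (u : TemperedDistribution ℝ ℂ) (1 : ℝ)
  rw [h1, Lp.fourier_toTemperedDistribution_eq, Lp.fourier_toTemperedDistribution_eq] at h2
  have hl1 : LocallyIntegrable ((𝓕 v : L2R) : ℝ → ℂ) volume :=
    (Lp.memLp _).locallyIntegrable (by norm_num)
  have hl0 : LocallyIntegrable ((𝓕 u : L2R) : ℝ → ℂ) volume :=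
    (Lp.memLp _).locallyIntegrable (by norm_num)
  have hl2 : LocallyIntegrable
      (fun ξ : ℝ => 2 * Real.pi * Complex.I * ξ * (𝓕 u : L2R) ξ) volume :=
    (hl0.locallyIntegrableOn Set.univ).continuousOn_mul
      (g := fun ξ : ℝ => (2 * Real.pi * Complex.I * ξ : ℂ)) (by fun_prop)
      (IsOpen.isLocallyClosed isOpen_univ) |> locallyIntegrableOn_univ.1
  refine ae_eq_of_integral_contDiff_smul_eq hl1 hl2 fun θ hθ hc => ?_
  have hc' : HasCompactSupport (Complex.ofRealCLM ∘ θ) := hc.comp_left rfl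
  have hθ' : ContDiff ℝ ∞ (Complex.ofRealCLM ∘ θ) := by fun_prop
  have h3 := congrArg (fun T : TemperedDistribution ℝ ℂ => T (hc'.toSchwartzMap hθ')) h2
  have htg : (fun x : ℝ => (x : ℂ)).HasTemperateGrowth := by fun_prop
  simp [Lp.toTemperedDistribution_apply] at h3
  simp only [Complex.real_smul]
  rw [h3, ← integral_const_mul]
  refine integral_congr_ae (Filter.Eventually.of_forall fun y => ?_)
  simp [SchwartzMap.smulLeftCLM_apply_apply htg]
  ring

end

/-! ### Multiplication by bounded functions, seen on the Fourier side -/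

section

open scoped ContDiff

/-- Multiplication by `f`, conjugated with the Fourier transform. -/
noncomputable def freqMul (f : ℝ → ℝ) : L2R →L[ℂ] L2R :=
  (Lp.fourierTransformₗᵢ ℝ ℂ).toContinuousLinearEquiv.toContinuousLinearMap ∘L
    mulOp (fun y => (f y : ℂ)) ∘L
    (Lp.fourierTransformₗᵢ ℝ ℂ).symm.toContinuousLinearEquiv.toContinuousLinearMap

theorem freqMul_fourier (f : ℝ → ℝ) (u : L2R) :
    freqMul f (𝓕 u) = 𝓕 (mulOp (fun y => (f y : ℂ)) u) := by
  have : 𝓕⁻ (𝓕 u) = u := FourierTransform.fourierInv_fourier_eq u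
  change 𝓕 (mulOp (fun y => (f y : ℂ)) (𝓕⁻ (𝓕 u))) = _
  rw [this]

theorem memLp_top_ofReal {f : ℝ → ℝ} (hf : MemLp f ∞ (volume : Measure ℝ)) :
    MemLp (fun y => (f y : ℂ)) ∞ (volume : Measure ℝ) := hf.ofReal

theorem norm_freqMul_le {f : ℝ → ℝ} (hf : MemLp f ∞ (volume : Measure ℝ)) {b : ℝ}
    (hb : ∀ᵐ y, |f y| ≤ b) : ‖freqMul f‖ ≤ b := by
  have hb0 : 0 ≤ b := by
    obtain ⟨x, hx⟩ := hb.exists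
    exact (abs_nonneg _).trans hx
  refine ContinuousLinearMap.opNorm_le_bound _ hb0 fun u => ?_
  obtain ⟨w, rfl⟩ : ∃ w : L2R, u = 𝓕 w := ⟨𝓕⁻ u, (FourierTransform.fourier_fourierInv_eq u).symm⟩
  rw [freqMul_fourier, Lp.norm_fourier_eq, Lp.norm_fourier_eq]
  exact norm_mulOp_apply_le (memLp_top_ofReal hf) (by simpa using hb) w

open scoped InnerProductSpace in
theorem re_inner_freqMul_ge {f : ℝ → ℝ} (hf : MemLp f ∞ (volume : Measure ℝ)) {c : ℝ}
    (hc : ∀ᵐ y, c ≤ f y) (u : L2R) : c * ‖u‖ ^ 2 ≤ (⟪u, freqMul f u⟫_ℂ).re := by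
  obtain ⟨w, rfl⟩ : ∃ w : L2R, u = 𝓕 w := ⟨𝓕⁻ u, (FourierTransform.fourier_fourierInv_eq u).symm⟩
  rw [freqMul_fourier, Lp.norm_fourier_eq, Lp.inner_fourier_eq]
  obtain ⟨hi, he⟩ := re_inner_mulOp (memLp_top_ofReal hf) w
  obtain ⟨hi1, he1⟩ := re_inner_mulOp (m := fun _ => 1) (memLp_top_const _) w
  have h1 : ‖w‖ ^ 2 = ∫ x, 1 * ‖w x‖ ^ 2 := by
    rw [← he1]
    simp only [Complex.ofReal_one, mulOp_one, ContinuousLinearMap.id_apply]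
    exact (inner_self_eq_norm_sq (𝕜 := ℂ) w).symm
  rw [he, h1, ← integral_const_mul]
  refine integral_mono_ae (hi1.const_mul c) hi ?_
  filter_upwards [hc] with y hy
  rw [one_mul]
  gcongr

/-- A bounded symbol which inverts `1 + ∂`; it turns the relation `HasFreqDeriv` into an equation
between bounded operators. -/
noncomputable def resolventSymbol (ξ : ℝ) : ℂ := (1 + 2 * Real.pi * Complex.I * ξ)⁻¹

theorem one_add_two_pi_I_ne_zero (ξ : ℝ) : (1 + 2 * Real.pi * Complex.I * ξ : ℂ) ≠ 0 := by
  intro h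
  have := congrArg Complex.re h
  simp at this

theorem contDiff_resolventSymbol : ContDiff ℝ ∞ resolventSymbol := by
  have h1 : ContDiff ℝ ∞ (fun ξ : ℝ => (1 + 2 * Real.pi * Complex.I * ξ : ℂ)) :=
    contDiff_const.add (contDiff_const.mul Complex.ofRealCLM.contDiff)
  exact h1.inv one_add_two_pi_I_ne_zero

theorem memLp_resolventSymbol : MemLp resolventSymbol ∞ (volume : Measure ℝ) := by
  refine memLp_top_of_bound contDiff_resolventSymbol.continuous.aestronglyMeasurable 1
    (Filter.Eventually.of_forall fun ξ => ?_)
  rw [resolventSymbol, norm_inv]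
  refine inv_le_one_of_one_le₀ ?_
  have h := Complex.abs_re_le_norm (1 + 2 * Real.pi * Complex.I * ξ : ℂ)
  simpa using h

theorem hasFreqDeriv_iff {u v : L2R} :
    HasFreqDeriv u v ↔ mulOp resolventSymbol (u + v) = u := by
  constructor
  · intro h
    refine Lp.ext ?_
    filter_upwards [h, coeFn_mulOp memLp_resolventSymbol (u + v), Lp.coeFn_add u v] with x h1 h2 h3
    rw [h2, h3, Pi.add_apply, h1, resolventSymbol, inv_mul_eq_iff_eq_mul₀
      (one_add_two_pi_I_ne_zero x)]
    ring
  · intro h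
    have h2 := coeFn_mulOp memLp_resolventSymbol (u + v)
    rw [h] at h2
    filter_upwards [h2, Lp.coeFn_add u v] with x h2 h3
    rw [h3, Pi.add_apply, resolventSymbol, eq_comm, inv_mul_eq_iff_eq_mul₀
      (one_add_two_pi_I_ne_zero x)] at h2
    linear_combination h2

theorem hasWeakDeriv_const (a : ℝ) : HasWeakDeriv (fun _ => a) (fun _ : ℝ => (0 : ℝ)) := by
  refine ⟨locallyIntegrable_const _, locallyIntegrable_const _, fun φ hφ hc => ?_⟩
  have h : ∫ y, a * deriv φ y = -∫ y, (0 : ℝ) * φ y :=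
    integral_mul_deriv_eq_deriv_mul_of_integrable (u := fun _ => a) (u' := fun _ => 0) (v := φ)
      (fun x _ => hasDerivAt_const x a)
      (fun x _ => (hφ.differentiable (by simp) x).hasDerivAt)
      (((hφ.continuous_deriv (by simp)).integrable_of_hasCompactSupport hc.deriv).const_mul a)
      (by simp [Pi.mul_def]) ((hφ.continuous.integrable_of_hasCompactSupport hc).const_mul a)
  simpa [mul_comm] using h

/-- The product rule for the weak derivative of a function in `W^{1,∞}` times a Schwartz
function. -/
theorem HasWeakDeriv.mulOp_schwartz {f f' : ℝ → ℝ} (hf : MemLp f ∞ (volume : Measure ℝ))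
    (hf' : MemLp f' ∞ (volume : Measure ℝ)) (h : HasWeakDeriv f f') (w : SchwartzMap ℝ ℂ) :
    HasWeakDeriv (mulOp (fun y => (f y : ℂ)) (w.toLp 2) : L2R)
      (mulOp (fun y => (f y : ℂ)) ((SchwartzMap.derivCLM ℂ ℂ w).toLp 2) +
        mulOp (fun y => (f' y : ℂ)) (w.toLp 2) : L2R) := by
  refine ⟨(Lp.memLp _).locallyIntegrable (by norm_num),
    (Lp.memLp _).locallyIntegrable (by norm_num), fun φ hφ hc => ?_⟩
  have hwd : ∀ y, HasDerivAt w (deriv w y) y := fun y => (w.differentiable y).hasDerivAt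
  have hφd : ∀ y, HasDerivAt φ (deriv φ y) y := fun y =>
    (hφ.differentiable (by simp) y).hasDerivAt
  have hsm : ContDiff ℝ ∞ (fun y => (φ y : ℂ) * w y) :=
    (Complex.ofRealCLM.contDiff.comp hφ).mul (w.smooth _)
  have hcc : HasCompactSupport (fun y => (φ y : ℂ) * w y) :=
    (hc.comp_left (g := fun x : ℝ => (x : ℂ)) (by simp)).mul_right
  have key := h.ofReal.integral_deriv_mul hsm hcc
  have hd : ∀ y, deriv (fun y => (φ y : ℂ) * w y) y = deriv φ y * w y + φ y * deriv w y := by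
    intro y
    exact ((hφd y).ofReal_comp.mul (hwd y)).deriv
  simp only [hd] at key
  have hfl : LocallyIntegrable (fun y => (f y : ℂ)) volume := h.ofReal.1
  have i1 : Integrable (fun y => (deriv φ y * w y) * (f y : ℂ)) volume := by
    have := hfl.integrable_smul_left_of_hasCompactSupport
      (g := fun y => ((deriv φ y : ℝ) : ℂ) * w y)
      ((Complex.continuous_ofReal.comp (hφ.continuous_deriv (by simp))).mul w.continuous)
      (hc.deriv.comp_left (g := fun x : ℝ => (x : ℂ)) (by simp)).mul_right
    simpa using this
  have i2 : Integrable (fun y => (φ y * deriv w y) * (f y : ℂ)) volume := by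
    have := hfl.integrable_smul_left_of_hasCompactSupport
      (g := fun y => (φ y : ℂ) * deriv w y)
      ((Complex.continuous_ofReal.comp hφ.continuous).mul
        (SchwartzMap.derivCLM ℂ ℂ w).continuous)
      (hc.comp_left (g := fun x : ℝ => (x : ℂ)) (by simp)).mul_right
    simpa using this
  have i3 : Integrable (fun y => (φ y * w y) * (f' y : ℂ)) volume := by
    have := h.ofReal.2.1.integrable_smul_left_of_hasCompactSupport hsm.continuous hcc
    simpa using this
  have e1 : ∫ y, deriv φ y • (mulOp (fun y => (f y : ℂ)) (w.toLp 2) : L2R) y =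
      ∫ y, (deriv φ y * w y) * (f y : ℂ) := by
    refine integral_congr_ae ?_
    filter_upwards [coeFn_mulOp (memLp_top_ofReal hf) (w.toLp 2), w.coeFn_toLp 2 volume]
      with y h1 h2
    rw [h1, h2, Complex.real_smul]
    ring
  have e2 : ∫ y, φ y • (mulOp (fun y => (f y : ℂ)) ((SchwartzMap.derivCLM ℂ ℂ w).toLp 2) +
      mulOp (fun y => (f' y : ℂ)) (w.toLp 2) : L2R) y =
      (∫ y, (φ y * deriv w y) * (f y : ℂ)) + ∫ y, (φ y * w y) * (f' y : ℂ) := by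
    rw [← integral_add i2 i3]
    refine integral_congr_ae ?_
    filter_upwards [coeFn_mulOp (memLp_top_ofReal hf) ((SchwartzMap.derivCLM ℂ ℂ w).toLp 2),
      coeFn_mulOp (memLp_top_ofReal hf') (w.toLp 2), w.coeFn_toLp 2 volume,
      (SchwartzMap.derivCLM ℂ ℂ w).coeFn_toLp 2 volume,
      Lp.coeFn_add (mulOp (fun y => (f y : ℂ)) ((SchwartzMap.derivCLM ℂ ℂ w).toLp 2))
        (mulOp (fun y => (f' y : ℂ)) (w.toLp 2))] with y h1 h2 h3 h4 h5
    rw [h5, Pi.add_apply, h1, h2, h3, h4, Complex.real_smul, SchwartzMap.derivCLM_apply]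
    ring
  rw [e1, e2]
  have e3 : ∫ y, (deriv φ y * w y + φ y * deriv w y) * (f y : ℂ) =
      (∫ y, (deriv φ y * w y) * (f y : ℂ)) + ∫ y, (φ y * deriv w y) * (f y : ℂ) := by
    rw [← integral_add i1 i2]
    exact integral_congr_ae (Filter.Eventually.of_forall fun y => by ring)
  rw [e3] at key
  linear_combination key

/-- The product rule `∂(f u) = f ∂u + f' u` for `f ∈ W^{1,∞}` and `u ∈ H¹`, on the Fourier side.
Both sides are bounded operators applied to `u + ∂u`, so that Schwartz functions suffice. -/
theorem HasWeakDeriv.freqMul_leibniz {f f' : ℝ → ℝ} (hf : MemLp f ∞ (volume : Measure ℝ))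
    (hf' : MemLp f' ∞ (volume : Measure ℝ)) (h : HasWeakDeriv f f') {u v : L2R}
    (huv : HasFreqDeriv u v) :
    HasFreqDeriv (freqMul f u) (freqMul f v + freqMul f' u) := by
  have main : ∀ z : L2R,
      (mulOp resolventSymbol ∘L (freqMul f + freqMul f' ∘L mulOp resolventSymbol)) z =
        (freqMul f ∘L mulOp resolventSymbol) z := by
    have hd := Lp.dense_hasCompactSupport_contDiff (E := ℝ) (F := ℂ)
      (μ := (volume : Measure ℝ)) (p := 2) (by norm_num)
    refine fun z => congrFun (Continuous.ext_on hd (ContinuousLinearMap.continuous _)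
      (ContinuousLinearMap.continuous _) ?_) z
    rintro z ⟨ζ, hζ, hc, hsm⟩
    have hc' : HasCompactSupport (fun ξ => resolventSymbol ξ * ζ ξ) := hc.mul_left
    have hsm' : ContDiff ℝ ∞ (fun ξ => resolventSymbol ξ * ζ ξ) :=
      contDiff_resolventSymbol.mul hsm
    let a : SchwartzMap ℝ ℂ := hc'.toSchwartzMap hsm'
    let w : SchwartzMap ℝ ℂ := 𝓕⁻ a
    have ha : mulOp resolventSymbol z = a.toLp 2 := by
      refine Lp.ext ?_
      filter_upwards [hζ, coeFn_mulOp memLp_resolventSymbol z, a.coeFn_toLp 2 volume]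
        with x h1 h2 h3
      rw [h2, h3, h1]
      rfl
    have hw : 𝓕 (w.toLp 2 : L2R) = mulOp resolventSymbol z := by
      rw [SchwartzMap.toLp_fourier_eq, ha]
      congr 1
      exact FourierTransform.fourier_fourierInv_eq a
    have hone := ((hasWeakDeriv_const 1).mulOp_schwartz (memLp_top_const _) (memLp_top_const _)
      w).hasFreqDeriv
    have h0 : mulOp (fun _ : ℝ => (0 : ℂ)) = 0 := by
      simpa using mulOp_const_mul (memLp_top_const (1 : ℂ)) 0
    simp only [Complex.ofReal_one, mulOp_one, Complex.ofReal_zero, h0, zero_apply,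
      ContinuousLinearMap.id_apply, add_zero] at hone
    rw [hasFreqDeriv_iff, hw] at hone
    have hw' : 𝓕 ((SchwartzMap.derivCLM ℂ ℂ w).toLp 2 : L2R) = z - mulOp resolventSymbol z := by
      have hinj : Function.Injective (mulOp resolventSymbol) := by
        intro p q hpq
        refine Lp.ext ?_
        have h1 := coeFn_mulOp memLp_resolventSymbol p
        have h2 := coeFn_mulOp memLp_resolventSymbol q
        rw [hpq] at h1
        filter_upwards [h1, h2] with x h1 h2
        rw [h1] at h2
        exact mul_left_cancel₀ (inv_ne_zero (one_add_two_pi_I_ne_zero x)) h2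
      exact eq_sub_of_add_eq' (hinj hone)
    have hf2 := (h.mulOp_schwartz hf hf' w).hasFreqDeriv
    rw [FourierTransform.fourier_add, ← freqMul_fourier, ← freqMul_fourier, ← freqMul_fourier,
      hw, hw', hasFreqDeriv_iff, map_sub] at hf2
    simp only [ContinuousLinearMap.comp_apply, add_apply]
    refine Eq.trans (congrArg _ ?_) hf2
    abel
  have h1 := main (u + v)
  have h2 := hasFreqDeriv_iff.1 huv
  simp only [ContinuousLinearMap.comp_apply, add_apply, h2] at h1
  rw [hasFreqDeriv_iff]
  refine Eq.trans (congrArg _ ?_) h1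
  rw [map_add, add_assoc]

end

/-! ### Multiplication operators on the weighted Sobolev space -/

theorem coeFn_finsetSum {ι : Type*} (s : Finset ι) (u : ι → L2R) :
    ((∑ i ∈ s, u i : L2R) : ℝ → ℂ) =ᵐ[volume] ∑ i ∈ s, (u i : ℝ → ℂ) := by
  classical
  induction s using Finset.induction_on with
  | empty => simpa using Lp.coeFn_zero ℂ 2 (volume : Measure ℝ)
  | insert i s hi ih =>
    rw [Finset.sum_insert hi, Finset.sum_insert hi]
    exact (Lp.coeFn_add _ _).trans (Filter.EventuallyEq.rfl.add ih)

theorem HasFreqDeriv.add {u v u' v' : L2R} (h : HasFreqDeriv u u') (k : HasFreqDeriv v v') :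
    HasFreqDeriv (u + v) (u' + v') := by
  rw [hasFreqDeriv_iff] at *
  rw [add_add_add_comm, map_add, h, k]

theorem HasFreqDeriv.smul {u u' : L2R} (a : ℂ) (h : HasFreqDeriv u u') :
    HasFreqDeriv (a • u) (a • u') := by
  rw [hasFreqDeriv_iff] at *
  rw [← smul_add, map_smul, h]

theorem HasFreqDeriv.sum {ι : Type*} {s : Finset ι} {u u' : ι → L2R}
    (h : ∀ i ∈ s, HasFreqDeriv (u i) (u' i)) :
    HasFreqDeriv (∑ i ∈ s, u i) (∑ i ∈ s, u' i) := by
  rw [hasFreqDeriv_iff, ← Finset.sum_add_distrib, map_sum]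
  exact Finset.sum_congr rfl fun i hi => hasFreqDeriv_iff.1 (h i hi)

theorem HasFreqDeriv.mulOp {u u' : L2R} (h : HasFreqDeriv u u') {m : ℝ → ℂ}
    (hm : MemLp m ∞ (volume : Measure ℝ)) : HasFreqDeriv (mulOp m u) (mulOp m u') := by
  rw [hasFreqDeriv_iff] at *
  rw [← map_add, mulOp_comm memLp_resolventSymbol hm, h]

/-- The square of the weight of the norm `∑_{j ≤ s} ‖(ε ∂)^j u‖²` on the Fourier side. A small
parameter `ε` makes the terms with derivatives of a coefficient small. -/
noncomputable def sobWeightSq (s : ℕ) (ε ξ : ℝ) : ℝ :=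
  ∑ j ∈ Finset.range (s + 1), (ε * (2 * Real.pi * ξ)) ^ (2 * j)

/-- The symbol `(ε ∂)^j`, divided by the weight. The space `H^s` is represented by the functions
`v = p û` in `L²`, where `p` is the weight, and `u ↦ (ε ∂)^j u` then becomes multiplication of `v`
with this symbol; `j = 0` is the embedding of `H^s` into `L²`. -/
noncomputable def sobSymbol (s : ℕ) (ε : ℝ) (j : ℕ) (ξ : ℝ) : ℂ :=
  (ε * (2 * Real.pi * Complex.I * ξ)) ^ j / (Real.sqrt (sobWeightSq s ε ξ) : ℂ)

theorem pow_le_sobWeightSq {s j : ℕ} (hj : j ≤ s) (ε ξ : ℝ) :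
    (ε * (2 * Real.pi * ξ)) ^ (2 * j) ≤ sobWeightSq s ε ξ :=
  Finset.single_le_sum (f := fun j => (ε * (2 * Real.pi * ξ)) ^ (2 * j))
    (fun i _ => by rw [pow_mul]; positivity) (Finset.mem_range.2 (by omega))

theorem one_le_sobWeightSq (s : ℕ) (ε ξ : ℝ) : 1 ≤ sobWeightSq s ε ξ := by
  simpa using pow_le_sobWeightSq (Nat.zero_le s) ε ξ

theorem sqrt_sobWeightSq_pos (s : ℕ) (ε ξ : ℝ) : 0 < Real.sqrt (sobWeightSq s ε ξ) :=
  Real.sqrt_pos.2 (zero_lt_one.trans_le (one_le_sobWeightSq s ε ξ))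

theorem continuous_sobWeightSq (s : ℕ) (ε : ℝ) : Continuous (sobWeightSq s ε) := by
  unfold sobWeightSq
  fun_prop

theorem continuous_sobSymbol (s : ℕ) (ε : ℝ) (j : ℕ) : Continuous (sobSymbol s ε j) := by
  unfold sobSymbol
  refine Continuous.div (by fun_prop)
    (Complex.continuous_ofReal.comp (continuous_sobWeightSq s ε).sqrt) fun ξ => ?_
  exact_mod_cast (sqrt_sobWeightSq_pos s ε ξ).ne'

theorem norm_sobSymbol_sq (s : ℕ) (ε : ℝ) (j : ℕ) (ξ : ℝ) :
    ‖sobSymbol s ε j ξ‖ ^ 2 = (ε * (2 * Real.pi * ξ)) ^ (2 * j) / sobWeightSq s ε ξ := by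
  have h0 : 0 ≤ sobWeightSq s ε ξ := zero_le_one.trans (one_le_sobWeightSq s ε ξ)
  rw [sobSymbol, norm_div, div_pow, Complex.norm_real, Real.norm_eq_abs, sq_abs, Real.sq_sqrt h0,
    norm_pow, ← pow_mul, mul_comm j 2, pow_mul, pow_mul]
  congr 2
  simp only [norm_mul, Complex.norm_real, Complex.norm_I, Complex.norm_ofNat, mul_pow,
    Real.norm_eq_abs, sq_abs, mul_one]

theorem norm_sobSymbol_le {s j : ℕ} (hj : j ≤ s) (ε ξ : ℝ) : ‖sobSymbol s ε j ξ‖ ≤ 1 := by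
  have h : ‖sobSymbol s ε j ξ‖ ^ 2 ≤ 1 := by
    rw [norm_sobSymbol_sq]
    exact div_le_one_of_le₀ (pow_le_sobWeightSq hj ε ξ)
      (zero_le_one.trans (one_le_sobWeightSq s ε ξ))
  exact (sq_le_one_iff₀ (norm_nonneg _)).1 h

theorem memLp_sobSymbol {s j : ℕ} (hj : j ≤ s) (ε : ℝ) :
    MemLp (sobSymbol s ε j) ∞ (volume : Measure ℝ) :=
  memLp_top_of_bound (continuous_sobSymbol s ε j).aestronglyMeasurable 1
    (Filter.Eventually.of_forall (norm_sobSymbol_le hj ε))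

theorem sum_norm_sobSymbol_sq (s : ℕ) (ε ξ : ℝ) :
    ∑ j ∈ Finset.range (s + 1), ‖sobSymbol s ε j ξ‖ ^ 2 = 1 := by
  simp only [norm_sobSymbol_sq]
  rw [← Finset.sum_div]
  exact div_self (zero_lt_one.trans_le (one_le_sobWeightSq s ε ξ)).ne'

theorem sum_norm_mulOp_sobSymbol_sq (s : ℕ) (ε : ℝ) (v : L2R) :
    ∑ j ∈ Finset.range (s + 1), ‖mulOp (sobSymbol s ε j) v‖ ^ 2 = ‖v‖ ^ 2 := by
  have hv : ∀ w : L2R, ‖w‖ ^ 2 = ∫ x, ‖w x‖ ^ 2 := by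
    intro w
    obtain ⟨hi1, he1⟩ := re_inner_mulOp (m := fun _ => 1) (memLp_top_const _) w
    simp only [Complex.ofReal_one, mulOp_one, ContinuousLinearMap.id_apply, one_mul] at he1
    rw [← he1]
    exact (inner_self_eq_norm_sq (𝕜 := ℂ) w).symm
  simp only [hv]
  rw [← integral_finsetSum]
  · refine integral_congr_ae ?_
    have h : ∀ᵐ x : ℝ, ∀ j ∈ Finset.range (s + 1),
        mulOp (sobSymbol s ε j) v x = sobSymbol s ε j x * v x := by
      refine (Filter.eventually_all_finset _).2 fun j hj => ?_
      exact coeFn_mulOp (memLp_sobSymbol (by simpa [Nat.lt_succ_iff] using hj) ε) v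
    filter_upwards [h] with x hx
    rw [Finset.sum_congr rfl fun j hj => by rw [hx j hj, norm_mul, mul_pow], ← Finset.sum_mul,
      sum_norm_sobSymbol_sq, one_mul]
  · intro j _
    exact (Lp.memLp _).integrable_norm_pow (by norm_num)

/-- `f 0, …, f N` are bounded by `b`, each one the weak derivative of the one before. -/
structure BddChain (N : ℕ) (b : ℝ) (f : ℕ → ℝ → ℝ) : Prop where
  memLp : ∀ j ≤ N, MemLp (f j) ∞ (volume : Measure ℝ)
  bound : ∀ j ≤ N, ∀ᵐ y, |f j y| ≤ b
  hasWeakDeriv : ∀ j < N, HasWeakDeriv (f j) (f (j + 1))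

/-- The operator `u ↦ (ε ∂)^n (f_j (ε ∂)^m u)` on `H^s`, with the product rule carried out. -/
noncomputable def leibnizOp (s : ℕ) (ε : ℝ) (f : ℕ → ℝ → ℝ) : ℕ → ℕ → ℕ → (L2R →L[ℂ] L2R)
  | 0, j, m => freqMul (f j) ∘L mulOp (sobSymbol s ε m)
  | n + 1, j, m => leibnizOp s ε f n j (m + 1) + (ε : ℂ) • leibnizOp s ε f n (j + 1) m

open scoped ComplexConjugate in
/-- Multiplication by `f_j` on `H^s`. -/
noncomputable def sobMul (s : ℕ) (ε : ℝ) (f : ℕ → ℝ → ℝ) (j : ℕ) : L2R →L[ℂ] L2R :=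
  ∑ n ∈ Finset.range (s + 1), mulOp (fun ξ => conj (sobSymbol s ε n ξ)) ∘L leibnizOp s ε f n j 0

section

variable {s : ℕ} {ε b : ℝ} {f : ℕ → ℝ → ℝ} {N : ℕ}

theorem BddChain.nonneg (hf : BddChain N b f) : 0 ≤ b := by
  obtain ⟨x, hx⟩ := (hf.bound 0 (Nat.zero_le _)).exists
  exact (abs_nonneg _).trans hx

theorem BddChain.norm_freqMul_comp_le (hf : BddChain N b f) {j m : ℕ} (hj : j ≤ N) (hm : m ≤ s) :
    ‖freqMul (f j) ∘L mulOp (sobSymbol s ε m)‖ ≤ b := by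
  refine (ContinuousLinearMap.opNorm_comp_le _ _).trans ?_
  rw [← mul_one b]
  exact mul_le_mul (norm_freqMul_le (hf.memLp j hj) (hf.bound j hj))
    (norm_mulOp_le (memLp_sobSymbol hm ε) (Filter.Eventually.of_forall (norm_sobSymbol_le hm ε)))
    (norm_nonneg _) hf.nonneg

theorem BddChain.norm_leibnizOp_le (hf : BddChain N b f) (hε : 0 ≤ ε) (hε1 : ε ≤ 1) :
    ∀ n j m, n + m ≤ s → n + j ≤ N → ‖leibnizOp s ε f n j m‖ ≤ 2 ^ n * b
  | 0, j, m, hm, hj => by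
    simpa [leibnizOp] using hf.norm_freqMul_comp_le (ε := ε) (by omega) (by omega : m ≤ s)
  | n + 1, j, m, hm, hj => by
    have h1 := hf.norm_leibnizOp_le hε hε1 n j (m + 1) (by omega) (by omega)
    have h2 := hf.norm_leibnizOp_le hε hε1 n (j + 1) m (by omega) (by omega)
    calc ‖leibnizOp s ε f (n + 1) j m‖
        ≤ ‖leibnizOp s ε f n j (m + 1)‖ + ‖(ε : ℂ) • leibnizOp s ε f n (j + 1) m‖ :=
          norm_add_le _ _
      _ ≤ 2 ^ n * b + 1 * (2 ^ n * b) := by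
          rw [norm_smul, Complex.norm_real, Real.norm_eq_abs, abs_of_nonneg hε]
          gcongr
      _ = _ := by ring

theorem BddChain.norm_leibnizOp_sub_le (hf : BddChain N b f) (hε : 0 ≤ ε) (hε1 : ε ≤ 1) :
    ∀ n j m, n + m ≤ s → n + j ≤ N →
      ‖leibnizOp s ε f n j m - freqMul (f j) ∘L mulOp (sobSymbol s ε (n + m))‖ ≤ ε * (2 ^ n * b)
  | 0, j, m, hm, hj => by
    have := hf.nonneg
    simp only [leibnizOp, zero_add, sub_self, norm_zero]
    positivity
  | n + 1, j, m, hm, hj => by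
    have h1 := hf.norm_leibnizOp_sub_le hε hε1 n j (m + 1) (by omega) (by omega)
    have h2 := hf.norm_leibnizOp_le (s := s) hε hε1 n (j + 1) m (by omega) (by omega)
    rw [show n + (m + 1) = n + 1 + m by omega] at h1
    calc ‖leibnizOp s ε f (n + 1) j m - freqMul (f j) ∘L mulOp (sobSymbol s ε (n + 1 + m))‖
        = ‖(leibnizOp s ε f n j (m + 1) - freqMul (f j) ∘L mulOp (sobSymbol s ε (n + 1 + m))) +
            (ε : ℂ) • leibnizOp s ε f n (j + 1) m‖ := by
          rw [leibnizOp]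
          congr 1
          abel
      _ ≤ ε * (2 ^ n * b) + ε * (2 ^ n * b) := by
          refine (norm_add_le _ _).trans ?_
          rw [norm_smul, Complex.norm_real, Real.norm_eq_abs, abs_of_nonneg hε]
          gcongr
      _ = _ := by ring

theorem memLp_conj_sobSymbol {s j : ℕ} (hj : j ≤ s) (ε : ℝ) :
    MemLp (fun ξ => (starRingEnd ℂ) (sobSymbol s ε j ξ)) ∞ (volume : Measure ℝ) :=
  (memLp_sobSymbol hj ε).star

theorem BddChain.norm_sobMul_le (hf : BddChain N b f) (hε : 0 ≤ ε) (hε1 : ε ≤ 1) {j : ℕ}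
    (hj : s + j ≤ N) : ‖sobMul s ε f j‖ ≤ 2 ^ (s + 1) * b := by
  have h : ∀ n ∈ Finset.range (s + 1), ‖mulOp (fun ξ => (starRingEnd ℂ) (sobSymbol s ε n ξ)) ∘L
      leibnizOp s ε f n j 0‖ ≤ 2 ^ n * b := by
    intro n hn
    have hn' : n ≤ s := by simpa [Nat.lt_succ_iff] using hn
    refine (ContinuousLinearMap.opNorm_comp_le _ _).trans ?_
    rw [← one_mul (2 ^ n * b)]
    refine mul_le_mul (norm_mulOp_le (memLp_conj_sobSymbol hn' ε)
      (Filter.Eventually.of_forall fun ξ => ?_))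
      (hf.norm_leibnizOp_le hε hε1 n j 0 (by omega) (by omega)) (norm_nonneg _) zero_le_one
    rw [RCLike.norm_conj]
    exact norm_sobSymbol_le hn' ε ξ
  refine (norm_sum_le_of_le _ h).trans ?_
  rw [← Finset.sum_mul]
  have h2 : ∑ n ∈ Finset.range (s + 1), (2 : ℝ) ^ n ≤ 2 ^ (s + 1) := by
    rw [geom_sum_eq (by norm_num)]
    norm_num
  exact mul_le_mul_of_nonneg_right h2 hf.nonneg

open scoped InnerProductSpace in
/-- A multiplication operator with positive symbol is coercive on `H^s` for small `ε`. -/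
theorem BddChain.re_inner_sobMul_ge (hf : BddChain N b f) (hε : 0 ≤ ε) (hε1 : ε ≤ 1)
    (hs : s ≤ N) {c : ℝ} (hc : ∀ᵐ y, c ≤ f 0 y) (v : L2R) :
    (c - ε * (2 ^ (s + 1) * b)) * ‖v‖ ^ 2 ≤ (⟪v, sobMul s ε f 0 v⟫_ℂ).re := by
  have h : ∀ n ∈ Finset.range (s + 1),
      c * ‖mulOp (sobSymbol s ε n) v‖ ^ 2 - ε * (2 ^ n * b) * ‖v‖ ^ 2 ≤
        (⟪v, mulOp (fun ξ => (starRingEnd ℂ) (sobSymbol s ε n ξ))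
          (leibnizOp s ε f n 0 0 v)⟫_ℂ).re := by
    intro n hn
    have hn' : n ≤ s := by simpa [Nat.lt_succ_iff] using hn
    rw [← inner_mulOp_left (memLp_sobSymbol hn' ε)]
    set w := mulOp (sobSymbol s ε n) v with hw
    have hwv : ‖w‖ ≤ 1 * ‖v‖ := norm_mulOp_apply_le (memLp_sobSymbol hn' ε)
      (Filter.Eventually.of_forall (norm_sobSymbol_le hn' ε)) v
    have h1 := re_inner_freqMul_ge (hf.memLp 0 (Nat.zero_le _)) hc w
    have h2 := hf.norm_leibnizOp_sub_le (s := s) hε hε1 n 0 0 (by omega) (by omega)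
    have h3 := (ContinuousLinearMap.le_opNorm (leibnizOp s ε f n 0 0 -
      freqMul (f 0) ∘L mulOp (sobSymbol s ε (n + 0))) v).trans
      (mul_le_mul_of_nonneg_right h2 (norm_nonneg v))
    have h4 : leibnizOp s ε f n 0 0 v = freqMul (f 0) w + (leibnizOp s ε f n 0 0 -
      freqMul (f 0) ∘L mulOp (sobSymbol s ε (n + 0))) v := by
      simp [hw]
    rw [h4, inner_add_right, Complex.add_re]
    have h5 := neg_le_of_abs_le (Complex.abs_re_le_norm ⟪w, (leibnizOp s ε f n 0 0 -
      freqMul (f 0) ∘L mulOp (sobSymbol s ε (n + 0))) v⟫_ℂ)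
    have h6 := norm_inner_le_norm (𝕜 := ℂ) w ((leibnizOp s ε f n 0 0 -
      freqMul (f 0) ∘L mulOp (sobSymbol s ε (n + 0))) v)
    have h7 : ‖w‖ * ‖(leibnizOp s ε f n 0 0 -
      freqMul (f 0) ∘L mulOp (sobSymbol s ε (n + 0))) v‖ ≤ (1 * ‖v‖) * (ε * (2 ^ n * b) * ‖v‖) :=
      mul_le_mul hwv h3 (norm_nonneg _) (by positivity)
    nlinarith
  have h1 := Finset.sum_le_sum h
  rw [Finset.sum_sub_distrib, ← Finset.mul_sum, sum_norm_mulOp_sobSymbol_sq, ← Finset.sum_mul,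
    ← Finset.mul_sum, ← Finset.sum_mul] at h1
  have h2 : ∑ n ∈ Finset.range (s + 1), (2 : ℝ) ^ n ≤ 2 ^ (s + 1) := by
    rw [geom_sum_eq (by norm_num)]
    norm_num
  have h3 : (∑ n ∈ Finset.range (s + 1), (2 : ℝ) ^ n) * b ≤ 2 ^ (s + 1) * b :=
    mul_le_mul_of_nonneg_right h2 hf.nonneg
  have h4 : ε * ((∑ n ∈ Finset.range (s + 1), (2 : ℝ) ^ n) * b) * ‖v‖ ^ 2 ≤
    ε * (2 ^ (s + 1) * b) * ‖v‖ ^ 2 := by gcongr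
  have h5 : (⟪v, sobMul s ε f 0 v⟫_ℂ).re = ∑ n ∈ Finset.range (s + 1),
      (⟪v, mulOp (fun ξ => (starRingEnd ℂ) (sobSymbol s ε n ξ))
          (leibnizOp s ε f n 0 0 v)⟫_ℂ).re := by
    rw [sobMul, sum_apply, inner_sum, Complex.re_sum]
    rfl
  rw [h5]
  linarith

theorem BddChain.leibnizOp_hasFreqDeriv (hf : BddChain N b f) {v v' : L2R}
    (hv : HasFreqDeriv v v') :
    ∀ n j m, n + m ≤ s → n + j < N → HasFreqDeriv (leibnizOp s ε f n j m v)
      (leibnizOp s ε f n j m v' + leibnizOp s ε f n (j + 1) m v)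
  | 0, j, m, hm, hj => by
    exact (hf.hasWeakDeriv j (by omega)).freqMul_leibniz (hf.memLp _ (by omega))
      (hf.memLp _ (by omega)) (hv.mulOp (memLp_sobSymbol (by omega) ε))
  | n + 1, j, m, hm, hj => by
    have h1 := hf.leibnizOp_hasFreqDeriv hv n j (m + 1) (by omega) (by omega)
    have h2 := hf.leibnizOp_hasFreqDeriv hv n (j + 1) m (by omega) (by omega)
    have h3 := h1.add (h2.smul (ε : ℂ))
    simp only [leibnizOp, add_apply, smul_apply]
    rw [smul_add, add_add_add_comm] at h3
    exact h3

/-- The product rule on `H^s`. -/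
theorem BddChain.sobMul_leibniz (hf : BddChain N b f) {j : ℕ} (hj : s + j < N) {v v' : L2R}
    (hv : HasFreqDeriv v v') :
    HasFreqDeriv (sobMul s ε f j v) (sobMul s ε f j v' + sobMul s ε f (j + 1) v) := by
  have h : ∀ n ∈ Finset.range (s + 1), HasFreqDeriv
      (mulOp (fun ξ => (starRingEnd ℂ) (sobSymbol s ε n ξ)) (leibnizOp s ε f n j 0 v))
      (mulOp (fun ξ => (starRingEnd ℂ) (sobSymbol s ε n ξ)) (leibnizOp s ε f n j 0 v') +
        mulOp (fun ξ => (starRingEnd ℂ) (sobSymbol s ε n ξ)) (leibnizOp s ε f n (j + 1) 0 v)) := by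
    intro n hn
    have hn' : n ≤ s := by simpa [Nat.lt_succ_iff] using hn
    rw [← map_add]
    exact (hf.leibnizOp_hasFreqDeriv hv n j 0 (by omega) (by omega)).mulOp
      (memLp_conj_sobSymbol hn' ε)
  have h1 := HasFreqDeriv.sum h
  rw [Finset.sum_add_distrib] at h1
  simpa [sobMul, sum_apply] using h1

theorem BddChain.leibnizOp_ae_eq (hf : BddChain N b f) (hε : ε ≠ 0) (v : L2R) :
    ∀ n j m, n + m ≤ s → n + j ≤ N → ∀ᵐ ξ : ℝ, leibnizOp s ε f n j m v ξ =
      (ε * (2 * Real.pi * Complex.I * ξ)) ^ n * (freqMul (f j) (mulOp (sobSymbol s ε m) v) : L2R) ξ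
  | 0, j, m, hm, hj => by
    refine Filter.Eventually.of_forall fun ξ => ?_
    simp [leibnizOp]
  | n + 1, j, m, hm, hj => by
    have h1 := hf.leibnizOp_ae_eq hε v n j (m + 1) (by omega) (by omega)
    have h2 := hf.leibnizOp_ae_eq hε v n (j + 1) m (by omega) (by omega)
    have hd : HasFreqDeriv (mulOp (sobSymbol s ε m) v)
        ((ε⁻¹ : ℂ) • mulOp (sobSymbol s ε (m + 1)) v) := by
      rw [HasFreqDeriv]
      filter_upwards [coeFn_mulOp (memLp_sobSymbol (by omega : m ≤ s) ε) v,
        coeFn_mulOp (memLp_sobSymbol (by omega : m + 1 ≤ s) ε) v,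
        Lp.coeFn_smul (ε⁻¹ : ℂ) (mulOp (sobSymbol s ε (m + 1)) v)] with ξ h1 h2 h3
      rw [h3, Pi.smul_apply, h1, h2, smul_eq_mul, sobSymbol, sobSymbol, pow_succ]
      have : (ε : ℂ) ≠ 0 := by exact_mod_cast hε
      field_simp
    have h3 := (hf.hasWeakDeriv j (by omega)).freqMul_leibniz (hf.memLp _ (by omega))
      (hf.memLp _ (by omega)) hd
    rw [HasFreqDeriv, map_smul] at h3
    filter_upwards [h1, h2, h3, Lp.coeFn_add (leibnizOp s ε f n j (m + 1) v)
        ((ε : ℂ) • leibnizOp s ε f n (j + 1) m v),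
      Lp.coeFn_smul (ε : ℂ) (leibnizOp s ε f n (j + 1) m v),
      Lp.coeFn_add ((ε⁻¹ : ℂ) • freqMul (f j) (mulOp (sobSymbol s ε (m + 1)) v))
        (freqMul (f (j + 1)) (mulOp (sobSymbol s ε m) v)),
      Lp.coeFn_smul (ε⁻¹ : ℂ) (freqMul (f j) (mulOp (sobSymbol s ε (m + 1)) v))]
      with ξ h1 h2 h3 h4 h5 h6 h7
    have hε' : (ε : ℂ) ≠ 0 := by exact_mod_cast hε
    rw [h6, Pi.add_apply, h7, Pi.smul_apply, smul_eq_mul] at h3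
    simp only [leibnizOp, add_apply, smul_apply]
    rw [h4, Pi.add_apply, h5, Pi.smul_apply, smul_eq_mul, h1, h2, pow_succ]
    have h8 : (freqMul (f j) (mulOp (sobSymbol s ε (m + 1)) v) : L2R) ξ =
        ε * (2 * Real.pi * Complex.I * ξ * (freqMul (f j) (mulOp (sobSymbol s ε m) v) : L2R) ξ) -
        ε * (freqMul (f (j + 1)) (mulOp (sobSymbol s ε m) v) : L2R) ξ := by
      rw [← h3]
      field_simp
      ring
    rw [h8]
    ring

/-- The embedding of `H^s` into `L²` intertwines the two operators of multiplication by `f`. -/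
theorem BddChain.mulOp_sobMul (hf : BddChain N b f) (hε : ε ≠ 0) (hs : s ≤ N) (v : L2R) :
    mulOp (sobSymbol s ε 0) (sobMul s ε f 0 v) =
      freqMul (f 0) (mulOp (sobSymbol s ε 0) v) := by
  have h : ∀ᵐ ξ : ℝ, ∀ n ∈ Finset.range (s + 1),
      mulOp (sobSymbol s ε 0) (mulOp (fun ξ => (starRingEnd ℂ) (sobSymbol s ε n ξ))
        (leibnizOp s ε f n 0 0 v)) ξ =
      (‖sobSymbol s ε n ξ‖ ^ 2 : ℝ) * (freqMul (f 0) (mulOp (sobSymbol s ε 0) v) : L2R) ξ := by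
    refine (Filter.eventually_all_finset _).2 fun n hn => ?_
    have hn' : n ≤ s := by simpa [Nat.lt_succ_iff] using hn
    filter_upwards [hf.leibnizOp_ae_eq hε v n 0 0 (by omega) (by omega),
      coeFn_mulOp (memLp_conj_sobSymbol hn' ε) (leibnizOp s ε f n 0 0 v),
      coeFn_mulOp (memLp_sobSymbol (Nat.zero_le s) ε)
        (mulOp (fun ξ => (starRingEnd ℂ) (sobSymbol s ε n ξ)) (leibnizOp s ε f n 0 0 v))]
      with ξ h1 h2 h3
    rw [h3, h2, h1]
    have h4 : sobSymbol s ε 0 ξ * (ε * (2 * Real.pi * Complex.I * ξ)) ^ n = sobSymbol s ε n ξ := by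
      rw [sobSymbol, sobSymbol, pow_zero]
      ring
    have h5 := RCLike.conj_mul (sobSymbol s ε n ξ)
    have h6 : ((‖sobSymbol s ε n ξ‖ ^ 2 : ℝ) : ℂ) =
        (starRingEnd ℂ) (sobSymbol s ε n ξ) * sobSymbol s ε n ξ := by
      rw [h5]
      simp
    rw [h6]
    nth_rewrite 3 [← h4]
    ring
  have hsum : mulOp (sobSymbol s ε 0) (sobMul s ε f 0 v) = ∑ n ∈ Finset.range (s + 1),
      mulOp (sobSymbol s ε 0) (mulOp (fun ξ => (starRingEnd ℂ) (sobSymbol s ε n ξ))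
        (leibnizOp s ε f n 0 0 v)) := by
    rw [sobMul, sum_apply, map_sum]
    rfl
  rw [hsum]
  refine Lp.ext ?_
  filter_upwards [h, coeFn_finsetSum (Finset.range (s + 1)) fun n =>
      mulOp (sobSymbol s ε 0) (mulOp (fun ξ => (starRingEnd ℂ) (sobSymbol s ε n ξ))
        (leibnizOp s ε f n 0 0 v))] with ξ h1 h2
  rw [h2, Finset.sum_apply, Finset.sum_congr rfl h1, ← Finset.sum_mul, ← Complex.ofReal_sum,
    sum_norm_sobSymbol_sq, Complex.ofReal_one, one_mul]

end

/-! ### The shifted derivative and its resolvents -/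

section

open scoped InnerProductSpace

/-- `(N² + x²)^{-1/2}`. -/
noncomputable def lamFun (N x : ℝ) : ℝ := (Real.sqrt (N ^ 2 + x ^ 2))⁻¹

/-- On the Fourier side, `w = (∂/k - i t) u`. -/
def HasShiftDeriv (k t : ℝ) (u w : L2R) : Prop :=
  ∀ᵐ ξ : ℝ, w ξ = Complex.I * (2 * Real.pi * ξ / k - t : ℝ) * u ξ

/-- The operator `(N² - D²)^{-1/2}`, where `D = ∂/k - i t`. -/
noncomputable def lamOp (N k t : ℝ) : L2R →L[ℂ] L2R :=
  mulOp fun ξ => (lamFun N (2 * Real.pi * ξ / k - t) : ℂ)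

/-- The operator `D (N² - D²)^{-1/2}`, where `D = ∂/k - i t`. -/
noncomputable def rieszOp (N k t : ℝ) : L2R →L[ℂ] L2R :=
  mulOp fun ξ => Complex.I * ((2 * Real.pi * ξ / k - t) * lamFun N (2 * Real.pi * ξ / k - t) : ℝ)

section

variable {N k t : ℝ}

theorem lamFun_pos (hN : 0 < N) (x : ℝ) : 0 < lamFun N x := by
  unfold lamFun
  positivity

theorem lamFun_sq (hN : 0 < N) (x : ℝ) : N ^ 2 * lamFun N x ^ 2 + (x * lamFun N x) ^ 2 = 1 := by
  have h : 0 < N ^ 2 + x ^ 2 := by positivity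
  rw [mul_pow, ← add_mul, lamFun, inv_pow, Real.sq_sqrt h.le, mul_inv_cancel₀ h.ne']

theorem lamFun_le (hN : 1 ≤ N) (x : ℝ) : lamFun N x ≤ 1 := by
  have h := lamFun_sq (by linarith) x (N := N)
  have h0 := lamFun_pos (by linarith) x (N := N)
  have h1 : lamFun N x ^ 2 ≤ N ^ 2 * lamFun N x ^ 2 :=
    le_mul_of_one_le_left (sq_nonneg _) (one_le_pow₀ hN)
  nlinarith [sq_nonneg (x * lamFun N x)]

theorem abs_mul_lamFun_le (hN : 0 < N) (x : ℝ) : |x * lamFun N x| ≤ 1 := by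
  have h := lamFun_sq hN x
  rw [← sq_le_one_iff_abs_le_one]
  nlinarith [sq_nonneg (N * lamFun N x)]

theorem continuous_lamFun (hN : 0 < N) : Continuous (lamFun N) := by
  unfold lamFun
  refine Continuous.inv₀ (by fun_prop) fun x => ?_
  positivity

theorem memLp_lamSymbol (hN : 1 ≤ N) (k t : ℝ) :
    MemLp (fun ξ : ℝ => (lamFun N (2 * Real.pi * ξ / k - t) : ℂ)) ∞ volume := by
  have h := continuous_lamFun (by linarith : 0 < N)
  refine memLp_top_of_bound (Continuous.aestronglyMeasurable (by fun_prop)) 1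
    (Filter.Eventually.of_forall fun ξ => ?_)
  rw [Complex.norm_real, Real.norm_eq_abs, abs_of_pos (lamFun_pos (by linarith) _)]
  exact lamFun_le hN _

theorem memLp_rieszSymbol (hN : 1 ≤ N) (k t : ℝ) :
    MemLp (fun ξ : ℝ => Complex.I *
      ((2 * Real.pi * ξ / k - t) * lamFun N (2 * Real.pi * ξ / k - t) : ℝ)) ∞ volume := by
  have h := continuous_lamFun (by linarith : 0 < N)
  refine memLp_top_of_bound (Continuous.aestronglyMeasurable (by fun_prop)) 1
    (Filter.Eventually.of_forall fun ξ => ?_)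
  rw [norm_mul, Complex.norm_I, one_mul, Complex.norm_real, Real.norm_eq_abs]
  exact abs_mul_lamFun_le (by linarith) _

theorem norm_lamOp_apply_le (hN : 1 ≤ N) (v : L2R) : ‖lamOp N k t v‖ ≤ ‖v‖ := by
  rw [← one_mul ‖v‖]
  refine norm_mulOp_apply_le (memLp_lamSymbol hN k t) (Filter.Eventually.of_forall fun ξ => ?_) v
  rw [Complex.norm_real, Real.norm_eq_abs, abs_of_pos (lamFun_pos (by linarith) _)]
  exact lamFun_le hN _

theorem norm_rieszOp_apply_le (hN : 1 ≤ N) (v : L2R) : ‖rieszOp N k t v‖ ≤ ‖v‖ := by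
  rw [← one_mul ‖v‖]
  refine norm_mulOp_apply_le (memLp_rieszSymbol hN k t) (Filter.Eventually.of_forall fun ξ => ?_) v
  rw [norm_mul, Complex.norm_I, one_mul, Complex.norm_real, Real.norm_eq_abs]
  exact abs_mul_lamFun_le (by linarith) _

theorem inner_lamOp (hN : 1 ≤ N) (u v : L2R) :
    ⟪lamOp N k t u, v⟫_ℂ = ⟪u, lamOp N k t v⟫_ℂ := by
  rw [lamOp, inner_mulOp_left (memLp_lamSymbol hN k t)]
  simp only [Complex.conj_ofReal]

theorem inner_rieszOp (hN : 1 ≤ N) (u v : L2R) :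
    ⟪rieszOp N k t u, v⟫_ℂ = -⟪u, rieszOp N k t v⟫_ℂ := by
  rw [rieszOp, inner_mulOp_left (memLp_rieszSymbol hN k t)]
  have h : ∀ a : ℝ, (starRingEnd ℂ) (Complex.I * a) = (-1) * (Complex.I * a) := by
    intro a
    simp
  simp only [h]
  rw [mulOp_const_mul (memLp_rieszSymbol hN k t), smul_apply, inner_smul_right]
  ring

/-- The resolution of the identity `N² Λ² - R² = 1`. -/
theorem lamOp_rieszOp_resolution (hN : 1 ≤ N) (v : L2R) :
    ((N ^ 2 : ℝ) : ℂ) • lamOp N k t (lamOp N k t v) - rieszOp N k t (rieszOp N k t v) = v := by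
  refine Lp.ext ?_
  have m1 := memLp_lamSymbol hN k t
  have m2 := memLp_rieszSymbol hN k t
  filter_upwards [coeFn_mulOp m1 v, coeFn_mulOp m1 (lamOp N k t v), coeFn_mulOp m2 v,
    coeFn_mulOp m2 (rieszOp N k t v),
    Lp.coeFn_sub (((N ^ 2 : ℝ) : ℂ) • lamOp N k t (lamOp N k t v))
      (rieszOp N k t (rieszOp N k t v)),
    Lp.coeFn_smul ((N ^ 2 : ℝ) : ℂ) (lamOp N k t (lamOp N k t v))] with ξ h1 h2 h3 h4 h5 h6
  rw [h5, Pi.sub_apply, h6, Pi.smul_apply, smul_eq_mul]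
  erw [h2, h4]
  erw [h1, h3]
  have h := congrArg (fun r : ℝ => (r : ℂ))
    (lamFun_sq (by linarith : 0 < N) (2 * Real.pi * ξ / k - t))
  simp only [Complex.ofReal_add, Complex.ofReal_mul, Complex.ofReal_pow, Complex.ofReal_one] at h ⊢
  linear_combination (v ξ) * h - ((2 * Real.pi * ξ / k - t : ℝ) *
    lamFun N (2 * Real.pi * ξ / k - t)) ^ 2 * (v ξ) * Complex.I_sq

theorem norm_sq_lamOp_add (hN : 1 ≤ N) (v : L2R) :
    N ^ 2 * ‖lamOp N k t v‖ ^ 2 + ‖rieszOp N k t v‖ ^ 2 = ‖v‖ ^ 2 := by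
  have h := congrArg (fun w => (⟪v, w⟫_ℂ).re) (lamOp_rieszOp_resolution (k := k) (t := t) hN v)
  simp only [inner_sub_right, inner_smul_right, Complex.sub_re] at h
  rw [← inner_lamOp hN, ← neg_neg ⟪v, rieszOp N k t (rieszOp N k t v)⟫_ℂ, ← inner_rieszOp hN, Complex.re_ofReal_mul,
    Complex.neg_re] at h
  have e : ∀ w : L2R, (⟪w, w⟫_ℂ).re = ‖w‖ ^ 2 := fun w => inner_self_eq_norm_sq (𝕜 := ℂ) w
  rw [e, e, e] at h
  linarith

theorem hasShiftDeriv_lamOp (hN : 1 ≤ N) (v : L2R) :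
    HasShiftDeriv k t (lamOp N k t v) (rieszOp N k t v) := by
  filter_upwards [coeFn_mulOp (memLp_lamSymbol hN k t) v,
    coeFn_mulOp (memLp_rieszSymbol hN k t) v] with ξ h1 h2
  erw [h1, h2]
  push_cast
  ring

theorem lamOp_rieszOp_comm (hN : 1 ≤ N) (v : L2R) :
    lamOp N k t (rieszOp N k t v) = rieszOp N k t (lamOp N k t v) :=
  mulOp_comm (memLp_lamSymbol hN k t) (memLp_rieszSymbol hN k t) v

theorem HasShiftDeriv.lamOp_eq {u w : L2R} (h : HasShiftDeriv k t u w) (hN : 1 ≤ N) :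
    lamOp N k t w = rieszOp N k t u := by
  refine Lp.ext ?_
  filter_upwards [coeFn_mulOp (memLp_lamSymbol hN k t) w,
    coeFn_mulOp (memLp_rieszSymbol hN k t) u, h] with ξ h1 h2 h3
  erw [h1, h2, h3]
  push_cast
  ring

/-- A function in the domain of `D` is in the range of `Λ`. -/
theorem HasShiftDeriv.eq_lamOp {u w : L2R} (h : HasShiftDeriv k t u w) :
    u = lamOp 1 k t (lamOp 1 k t u - rieszOp 1 k t w) := by
  have h1 := lamOp_rieszOp_resolution (k := k) (t := t) le_rfl u
  rw [← h.lamOp_eq le_rfl, ← lamOp_rieszOp_comm le_rfl] at h1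
  rw [map_sub]
  simpa using h1.symm

theorem HasShiftDeriv.unique {u w w' : L2R} (h : HasShiftDeriv k t u w)
    (h' : HasShiftDeriv k t u w') : w = w' := by
  refine Lp.ext ?_
  filter_upwards [h, h'] with ξ h1 h2
  rw [h1, h2]

theorem HasShiftDeriv.inner_eq {u u' v v' : L2R} (hu : HasShiftDeriv k t u u')
    (hv : HasShiftDeriv k t v v') : ⟪u', v⟫_ℂ = -⟪u, v'⟫_ℂ := by
  rw [L2.inner_def, L2.inner_def, ← integral_neg]
  refine integral_congr_ae ?_
  filter_upwards [hu, hv] with ξ h1 h2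
  rw [h1, h2]
  simp only [RCLike.inner_apply, map_mul, Complex.conj_I, Complex.conj_ofReal]
  ring

theorem HasFreqDeriv.hasShiftDeriv {u v : L2R} (h : HasFreqDeriv u v) :
    HasShiftDeriv k t u ((k⁻¹ : ℂ) • v - (Complex.I * t) • u) := by
  filter_upwards [h, Lp.coeFn_sub ((k⁻¹ : ℂ) • v) ((Complex.I * t) • u),
    Lp.coeFn_smul (k⁻¹ : ℂ) v, Lp.coeFn_smul (Complex.I * t : ℂ) u] with ξ h1 h2 h3 h4
  rw [h2, Pi.sub_apply, h3, h4, Pi.smul_apply, Pi.smul_apply, h1, smul_eq_mul, smul_eq_mul]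
  push_cast
  ring

theorem HasShiftDeriv.hasFreqDeriv (hk : k ≠ 0) {u w : L2R} (h : HasShiftDeriv k t u w) :
    HasFreqDeriv u ((k : ℂ) • (w + (Complex.I * t) • u)) := by
  filter_upwards [h, Lp.coeFn_smul (k : ℂ) (w + (Complex.I * t) • u),
    Lp.coeFn_add w ((Complex.I * t) • u), Lp.coeFn_smul (Complex.I * t : ℂ) u] with ξ h1 h2 h3 h4
  rw [h2, Pi.smul_apply, h3, Pi.add_apply, h4, Pi.smul_apply, h1, smul_eq_mul, smul_eq_mul]
  have : (k : ℂ) ≠ 0 := by exact_mod_cast hk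
  push_cast
  field_simp
  ring

/-- Replacing `1` by `N` in `(1 - D²)^{-1/2}` gives equivalent norms. -/
theorem norm_lamOp_le (hN : 1 ≤ N) (v : L2R) :
    ‖lamOp N k t v‖ ≤ ‖lamOp 1 k t v‖ ∧ ‖lamOp 1 k t v‖ ≤ N * ‖lamOp N k t v‖ := by
  have hN0 : 0 < N := by linarith
  have hN2 : 1 ≤ N ^ 2 := one_le_pow₀ hN
  have m1 := memLp_lamSymbol le_rfl k t
  have m2 := memLp_lamSymbol hN k t
  constructor
  · refine Lp.norm_le_norm_of_ae_le ?_
    filter_upwards [coeFn_mulOp m1 v, coeFn_mulOp m2 v] with ξ h1 h2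
    erw [h1, h2]
    rw [norm_mul, norm_mul, Complex.norm_real, Complex.norm_real, Real.norm_eq_abs,
      Real.norm_eq_abs, abs_of_pos (lamFun_pos hN0 _), abs_of_pos (lamFun_pos one_pos _)]
    refine mul_le_mul_of_nonneg_right ?_ (norm_nonneg _)
    unfold lamFun
    gcongr
  · refine Lp.norm_le_mul_norm_of_ae_le_mul ?_
    filter_upwards [coeFn_mulOp m1 v, coeFn_mulOp m2 v] with ξ h1 h2
    erw [h1, h2]
    rw [norm_mul, norm_mul, Complex.norm_real, Complex.norm_real, Real.norm_eq_abs,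
      Real.norm_eq_abs, abs_of_pos (lamFun_pos hN0 _), abs_of_pos (lamFun_pos one_pos _),
      ← mul_assoc]
    refine mul_le_mul_of_nonneg_right ?_ (norm_nonneg _)
    set x := 2 * Real.pi * ξ / k - t
    unfold lamFun
    rw [← div_eq_mul_inv, le_div_iff₀ (by positivity), inv_mul_le_iff₀ (by positivity)]
    refine Real.sqrt_le_iff.2 ⟨by positivity, ?_⟩
    rw [mul_pow, Real.sq_sqrt (by positivity)]
    nlinarith [mul_nonneg (sub_nonneg.2 hN2) (sq_nonneg x)]

end

/-! ### The elliptic estimate -/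

/-- `G` and `G'` act like the multiplications by a function `g` and by its derivative, with norms
at most `b`. -/
structure IsMulPair (b : ℝ) (G G' : L2R →L[ℂ] L2R) : Prop where
  norm_le : ‖G‖ ≤ b
  norm_le' : ‖G'‖ ≤ b
  leibniz : ∀ u v, HasFreqDeriv u v → HasFreqDeriv (G u) (G v + G' u)

/-- The operator `(1/g) - D g D`, preconditioned with `Λ = (1 - D²)^{-1/2}` on both sides. -/
noncomputable def ellOp (G : L2R →L[ℂ] L2R) (k t : ℝ) : L2R →L[ℂ] L2R :=
  lamOp 1 k t ∘L Ring.inverse G ∘L lamOp 1 k t - rieszOp 1 k t ∘L G ∘L rieszOp 1 k t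

/-- The generator `w ↦ (i f / k) Φ` of the evolution, where `Φ` is the stream function of `w`. -/
noncomputable def genOp (G F : L2R →L[ℂ] L2R) (k t : ℝ) : L2R →L[ℂ] L2R :=
  (-(Complex.I / k)) • (F ∘L lamOp 1 k t ∘L Ring.inverse (ellOp G k t) ∘L lamOp 1 k t ∘L
    Ring.inverse G)

section

variable {b c k t κ : ℝ} {G G' F F' : L2R →L[ℂ] L2R}

theorem IsMulPair.norm_apply_le (h : IsMulPair b G G') (v : L2R) : ‖G v‖ ≤ b * ‖v‖ :=
  G.le_of_opNorm_le h.norm_le v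

theorem IsMulPair.norm_apply_le' (h : IsMulPair b G G') (v : L2R) : ‖G' v‖ ≤ b * ‖v‖ :=
  G'.le_of_opNorm_le h.norm_le' v

theorem IsMulPair.shift (h : IsMulPair b G G') (hk : k ≠ 0) {u w : L2R}
    (huw : HasShiftDeriv k t u w) : HasShiftDeriv k t (G u) (G w + (k⁻¹ : ℂ) • G' u) := by
  have h1 := (h.leibniz _ _ (huw.hasFreqDeriv hk)).hasShiftDeriv (k := k) (t := t)
  have hk' : (k : ℂ) ≠ 0 := by exact_mod_cast hk
  have h2 : (k⁻¹ : ℂ) • (G ((k : ℂ) • (w + (Complex.I * t) • u)) + G' u) -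
      (Complex.I * t) • G u = G w + (k⁻¹ : ℂ) • G' u := by
    rw [map_smul, smul_add, smul_smul, inv_mul_cancel₀ hk', one_smul, map_add, map_smul]
    abel
  rwa [h2] at h1

theorem apply_inverse_of_isUnit {T : L2R →L[ℂ] L2R} (h : IsUnit T) (v : L2R) :
    T (Ring.inverse T v) = v := by
  have := congrArg (fun S : L2R →L[ℂ] L2R => S v) (Ring.mul_inverse_cancel T h)
  simpa using this

theorem inverse_apply_of_isUnit {T : L2R →L[ℂ] L2R} (h : IsUnit T) (v : L2R) :
    Ring.inverse T (T v) = v := by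
  have := congrArg (fun S : L2R →L[ℂ] L2R => S v) (Ring.inverse_mul_cancel T h)
  simpa using this

theorem re_inner_inverse_ge (hc : 0 < c) (hb : 0 < b) (hG : ‖G‖ ≤ b)
    (hco : ∀ v, c * ‖v‖ ^ 2 ≤ (⟪v, G v⟫_ℂ).re) (v : L2R) :
    c / b ^ 2 * ‖v‖ ^ 2 ≤ (⟪v, Ring.inverse G v⟫_ℂ).re := by
  have hu := isUnit_of_coercive G hc hco
  set z := Ring.inverse G v with hz
  have hv : v = G z := (apply_inverse_of_isUnit hu v).symm
  have h1 := hco z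
  have h2 : (⟪z, G z⟫_ℂ).re = (⟪G z, z⟫_ℂ).re := inner_re_symm (𝕜 := ℂ) _ _
  have h3 := G.le_of_opNorm_le hG z
  rw [hv, ← h2]
  refine le_trans ?_ h1
  rw [div_mul_eq_mul_div, div_le_iff₀ (by positivity), mul_assoc]
  refine mul_le_mul_of_nonneg_left ?_ hc.le
  calc ‖G z‖ ^ 2 ≤ (b * ‖z‖) ^ 2 := by gcongr
    _ = _ := by ring

/-- The constant of coercivity of the preconditioned operator. -/
theorem re_inner_ellOp_ge (hc : 0 < c) (hb : 0 < b) (hG : ‖G‖ ≤ b)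
    (hco : ∀ v, c * ‖v‖ ^ 2 ≤ (⟪v, G v⟫_ℂ).re) (v : L2R) :
    min c (c / b ^ 2) * ‖v‖ ^ 2 ≤ (⟪v, ellOp G k t v⟫_ℂ).re := by
  have h1 := re_inner_inverse_ge hc hb hG hco (lamOp 1 k t v)
  have h2 := hco (rieszOp 1 k t v)
  have h3 := norm_sq_lamOp_add (k := k) (t := t) le_rfl v
  have h4 : ⟪v, ellOp G k t v⟫_ℂ = ⟪lamOp 1 k t v, Ring.inverse G (lamOp 1 k t v)⟫_ℂ +
      ⟪rieszOp 1 k t v, G (rieszOp 1 k t v)⟫_ℂ := by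
    rw [ellOp, sub_apply, inner_sub_right, inner_lamOp le_rfl, inner_rieszOp le_rfl]
    simp only [ContinuousLinearMap.comp_apply]
    ring
  rw [h4, Complex.add_re]
  rw [one_pow, one_mul] at h3
  rw [← h3, mul_add]
  have h5 : min c (c / b ^ 2) * ‖lamOp 1 k t v‖ ^ 2 ≤ c / b ^ 2 * ‖lamOp 1 k t v‖ ^ 2 :=
    mul_le_mul_of_nonneg_right (min_le_right _ _) (sq_nonneg _)
  have h6 : min c (c / b ^ 2) * ‖rieszOp 1 k t v‖ ^ 2 ≤ c * ‖rieszOp 1 k t v‖ ^ 2 :=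
    mul_le_mul_of_nonneg_right (min_le_left _ _) (sq_nonneg _)
  linarith

theorem isUnit_ellOp (hc : 0 < c) (hb : 0 < b) (hG : ‖G‖ ≤ b)
    (hco : ∀ v, c * ‖v‖ ^ 2 ≤ (⟪v, G v⟫_ℂ).re) : IsUnit (ellOp G k t) :=
  isUnit_of_coercive _ (by positivity : 0 < min c (c / b ^ 2)) (re_inner_ellOp_ge hc hb hG hco)

theorem norm_inverse_ellOp_apply_le (hc : 0 < c) (hb : 0 < b) (hG : ‖G‖ ≤ b)
    (hco : ∀ v, c * ‖v‖ ^ 2 ≤ (⟪v, G v⟫_ℂ).re) (v : L2R) :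
    min c (c / b ^ 2) * ‖Ring.inverse (ellOp G k t) v‖ ≤ ‖v‖ := by
  set z := Ring.inverse (ellOp G k t) v
  have hz : ellOp G k t z = v := apply_inverse_of_isUnit (isUnit_ellOp hc hb hG hco) v
  have h1 := re_inner_ellOp_ge (k := k) (t := t) hc hb hG hco z
  rw [hz] at h1
  have h2 : (⟪z, v⟫_ℂ).re ≤ ‖z‖ * ‖v‖ := re_inner_le_norm (𝕜 := ℂ) z v
  rcases (norm_nonneg z).eq_or_lt with h0 | h0
  · rw [← h0, mul_zero]
    exact norm_nonneg _
  · nlinarith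

/-- Multiplication by `g` is bounded below in the dual norm `‖Λ u‖`. The proof tests with
`(N² - D²)^{-1} z`; for large `N` the commutator of `g` with `D` is negligible. -/
theorem IsMulPair.norm_lamOp_le (h : IsMulPair b G G') (hc : 0 < c) (hb : 0 < b) (hk : k ≠ 0)
    (hκ : |k|⁻¹ ≤ κ) (hco : ∀ v, c * ‖v‖ ^ 2 ≤ (⟪v, G v⟫_ℂ).re) (z : L2R) :
    ‖lamOp 1 k t z‖ ≤ 2 * (1 + 2 * b * κ / c) / c * ‖lamOp 1 k t (G z)‖ := by
  have hκ0 : 0 ≤ κ := (by positivity : 0 ≤ |k|⁻¹).trans hκ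
  -- `N` is so large that the commutator term is at most half of the coercive terms, see `e7`
  set N : ℝ := 1 + 2 * b * κ / c with hNdef
  have hN : 1 ≤ N := by
    rw [hNdef]
    exact le_add_of_nonneg_right (by positivity)
  have hN0 : 0 < N := by linarith
  set y := lamOp N k t z with hy
  set a := lamOp N k t y with ha
  set a' := rieszOp N k t y with ha'
  set a'' := rieszOp N k t (rieszOp N k t z) with ha''
  have d1 : HasShiftDeriv k t a a' := hasShiftDeriv_lamOp hN y
  have d2 : HasShiftDeriv k t a' a'' := by
    rw [ha', hy, ← lamOp_rieszOp_comm hN]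
    exact hasShiftDeriv_lamOp hN _
  have hz : ((N ^ 2 : ℝ) : ℂ) • a - a'' = z := lamOp_rieszOp_resolution hN z
  have hsum : N ^ 2 * ‖a‖ ^ 2 + ‖a'‖ ^ 2 = ‖y‖ ^ 2 := norm_sq_lamOp_add hN y
  have e1 : (⟪a, G z⟫_ℂ).re ≤ ‖y‖ * ‖lamOp N k t (G z)‖ := by
    rw [ha, inner_lamOp hN]
    exact re_inner_le_norm (𝕜 := ℂ) _ _
  have e2 := d1.inner_eq (h.shift hk d2)
  rw [inner_add_right, inner_smul_right] at e2
  have e3 : (⟪a, G z⟫_ℂ).re = N ^ 2 * (⟪a, G a⟫_ℂ).re + (⟪a', G a'⟫_ℂ).re +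
      ((k⁻¹ : ℂ) * ⟪a, G' a'⟫_ℂ).re := by
    have : ⟪a, G a''⟫_ℂ = -⟪a', G a'⟫_ℂ - (k⁻¹ : ℂ) * ⟪a, G' a'⟫_ℂ := by
      rw [e2]
      ring
    rw [← hz, map_sub, map_smul, inner_sub_right, inner_smul_right, this, Complex.sub_re,
      Complex.re_ofReal_mul, Complex.sub_re, Complex.neg_re]
    ring
  have hna : N * ‖a‖ ≤ ‖y‖ := by
    refine le_of_sq_le_sq ?_ (norm_nonneg _)
    nlinarith [sq_nonneg ‖a'‖]
  have hna' : ‖a'‖ ≤ ‖y‖ := norm_rieszOp_apply_le hN y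
  have e4 : -(κ * b * (‖a‖ * ‖y‖)) ≤ ((k⁻¹ : ℂ) * ⟪a, G' a'⟫_ℂ).re := by
    refine neg_le_of_abs_le ((Complex.abs_re_le_norm _).trans ?_)
    rw [norm_mul, norm_inv, Complex.norm_real, Real.norm_eq_abs]
    have h1 : ‖⟪a, G' a'⟫_ℂ‖ ≤ ‖a‖ * (b * ‖y‖) := by
      refine (norm_inner_le_norm (𝕜 := ℂ) _ _).trans ?_
      gcongr
      refine (h.norm_apply_le' _).trans ?_
      gcongr
    calc |k|⁻¹ * ‖⟪a, G' a'⟫_ℂ‖ ≤ κ * (‖a‖ * (b * ‖y‖)) := by gcongr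
      _ = _ := by ring
  have e5 := hco a
  have e6 := hco a'
  have e7 : κ * b * (‖a‖ * ‖y‖) ≤ c / 2 * ‖y‖ ^ 2 := by
    have h1 : κ * b ≤ c / 2 * N := by
      rw [hNdef]
      have : c / 2 * (1 + 2 * b * κ / c) = c / 2 + κ * b := by
        field_simp
      linarith
    calc κ * b * (‖a‖ * ‖y‖) ≤ c / 2 * N * (‖a‖ * ‖y‖) := by gcongr
      _ = c / 2 * (N * ‖a‖) * ‖y‖ := by ring
      _ ≤ c / 2 * ‖y‖ * ‖y‖ := by gcongr
      _ = _ := by ring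
  have e8 : c / 2 * ‖y‖ ^ 2 ≤ ‖y‖ * ‖lamOp N k t (G z)‖ := by
    have : c * (N ^ 2 * ‖a‖ ^ 2 + ‖a'‖ ^ 2) ≤
        N ^ 2 * (⟪a, G a⟫_ℂ).re + (⟪a', G a'⟫_ℂ).re := by
      nlinarith [mul_le_mul_of_nonneg_left e5 (sq_nonneg N)]
    rw [hsum] at this
    linarith
  have e9 : c / 2 * ‖y‖ ≤ ‖lamOp N k t (G z)‖ := by
    rcases (norm_nonneg y).eq_or_lt with h0 | h0
    · rw [← h0, mul_zero]
      exact norm_nonneg _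
    · nlinarith
  have e10 := (_root_.norm_lamOp_le (k := k) (t := t) hN z).2
  have e11 := (_root_.norm_lamOp_le (k := k) (t := t) hN (G z)).1
  calc ‖lamOp 1 k t z‖ ≤ N * ‖y‖ := e10
    _ = 2 * N / c * (c / 2 * ‖y‖) := by field_simp
    _ ≤ 2 * N / c * ‖lamOp 1 k t (G z)‖ := by
        gcongr
        exact e9.trans e11

/-- Multiplication by `f` maps the domain of `D` to itself. -/
theorem IsMulPair.norm_inner_mul_lamOp_le (h : IsMulPair b F F') (hk : k ≠ 0)
    (hκ : |k|⁻¹ ≤ κ) (p v : L2R) :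
    ‖⟪p, F (lamOp 1 k t v)⟫_ℂ‖ ≤ b * (2 + κ) * (‖lamOp 1 k t p‖ * ‖v‖) := by
  have hb : 0 ≤ b := (norm_nonneg _).trans h.norm_le
  have d := h.shift hk (hasShiftDeriv_lamOp (k := k) (t := t) le_rfl v)
  rw [d.eq_lamOp, ← inner_lamOp le_rfl]
  refine (norm_inner_le_norm (𝕜 := ℂ) _ _).trans ?_
  have hl : ‖lamOp 1 k t v‖ ≤ ‖v‖ := norm_lamOp_apply_le le_rfl v
  have hr : ‖rieszOp 1 k t v‖ ≤ ‖v‖ := norm_rieszOp_apply_le le_rfl v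
  have h1 : ‖lamOp 1 k t (F (lamOp 1 k t v))‖ ≤ b * ‖v‖ :=
    ((norm_lamOp_apply_le le_rfl _).trans (h.norm_apply_le _)).trans (by gcongr)
  have h2 : ‖rieszOp 1 k t (F (rieszOp 1 k t v) + (k⁻¹ : ℂ) • F' (lamOp 1 k t v))‖ ≤
      b * ‖v‖ + κ * (b * ‖v‖) := by
    refine (norm_rieszOp_apply_le le_rfl _).trans ((norm_add_le _ _).trans ?_)
    rw [norm_smul, norm_inv, Complex.norm_real, Real.norm_eq_abs]
    have h3 : ‖F (rieszOp 1 k t v)‖ ≤ b * ‖v‖ := (h.norm_apply_le _).trans (by gcongr)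
    have h4 : ‖F' (lamOp 1 k t v)‖ ≤ b * ‖v‖ := (h.norm_apply_le' _).trans (by gcongr)
    have hκ0 : 0 ≤ κ := (by positivity : 0 ≤ |k|⁻¹).trans hκ
    gcongr
  calc _ ≤ ‖lamOp 1 k t p‖ * (b * ‖v‖ + (b * ‖v‖ + κ * (b * ‖v‖))) := by
        gcongr
        exact (norm_sub_le _ _).trans (add_le_add h1 h2)
    _ = _ := by ring

/-- The constant in the estimate of the generator in the dual norm. -/
noncomputable def genConst (b c κ : ℝ) : ℝ :=
  (2 + κ) * (2 * (1 + 2 * b * κ / c) / c) / min c (c / b ^ 2)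

theorem genConst_nonneg (hc : 0 < c) (hb : 0 < b) (hκ : 0 ≤ κ) : 0 ≤ genConst b c κ := by
  unfold genConst
  positivity

/-- The generator is bounded, and small for small `f`, from the dual norm to its predual. -/
theorem norm_inner_genOp_le {β : ℝ} (hG : IsMulPair b G G') (hF : IsMulPair β F F') (hc : 0 < c)
    (hb : 0 < b) (hk : k ≠ 0) (hκ : |k|⁻¹ ≤ κ)
    (hco : ∀ v, c * ‖v‖ ^ 2 ≤ (⟪v, G v⟫_ℂ).re) (p w : L2R) :
    ‖⟪p, genOp G F k t w⟫_ℂ‖ ≤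
      |k|⁻¹ * β * genConst b c κ * (‖lamOp 1 k t p‖ * ‖lamOp 1 k t w‖) := by
  have hβ : 0 ≤ β := (norm_nonneg _).trans hF.norm_le
  have hκ0 : 0 ≤ κ := (by positivity : 0 ≤ |k|⁻¹).trans hκ
  set v := Ring.inverse (ellOp G k t) (lamOp 1 k t (Ring.inverse G w)) with hv
  have h1 : genOp G F k t w = (-(Complex.I / k)) • F (lamOp 1 k t v) := rfl
  have hmin : 0 < min c (c / b ^ 2) := by positivity
  have h2 := norm_inverse_ellOp_apply_le (k := k) (t := t) hc hb hG.norm_le hco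
    (lamOp 1 k t (Ring.inverse G w))
  have h3 := hG.norm_lamOp_le (t := t) hc hb hk hκ hco (Ring.inverse G w)
  rw [apply_inverse_of_isUnit (isUnit_of_coercive G hc hco)] at h3
  have h4 := hF.norm_inner_mul_lamOp_le (t := t) hk hκ p v
  have h5 : ‖v‖ ≤ 2 * (1 + 2 * b * κ / c) / c / min c (c / b ^ 2) * ‖lamOp 1 k t w‖ := by
    rw [div_mul_eq_mul_div, le_div_iff₀ hmin]
    linarith
  rw [h1, inner_smul_right, norm_mul, norm_neg, norm_div, Complex.norm_I, Complex.norm_real,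
    Real.norm_eq_abs, one_div, genConst]
  calc |k|⁻¹ * ‖⟪p, F (lamOp 1 k t v)⟫_ℂ‖
      ≤ |k|⁻¹ * (β * (2 + κ) * (‖lamOp 1 k t p‖ *
          (2 * (1 + 2 * b * κ / c) / c / min c (c / b ^ 2) * ‖lamOp 1 k t w‖))) := by
        refine mul_le_mul_of_nonneg_left (h4.trans ?_) (by positivity)
        gcongr
    _ = _ := by ring

theorem norm_genOp_le {β : ℝ} (hG : IsMulPair b G G') (hF : IsMulPair β F F') (hc : 0 < c)
    (hb : 0 < b) (hk : k ≠ 0) (hκ : |k|⁻¹ ≤ κ)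
    (hco : ∀ v, c * ‖v‖ ^ 2 ≤ (⟪v, G v⟫_ℂ).re) :
    ‖genOp G F k t‖ ≤ |k|⁻¹ * β * genConst b c κ := by
  have hβ : 0 ≤ β := (norm_nonneg _).trans hF.norm_le
  have hκ0 : 0 ≤ κ := (by positivity : 0 ≤ |k|⁻¹).trans hκ
  have hC := genConst_nonneg hc hb hκ0
  refine ContinuousLinearMap.opNorm_le_bound _ (by positivity) fun w => ?_
  set p := genOp G F k t w with hp
  have h1 := norm_inner_genOp_le (t := t) hG hF hc hb hk hκ hco p w
  have h2 : ‖⟪p, genOp G F k t w⟫_ℂ‖ = ‖p‖ * ‖p‖ := by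
    rw [← hp, inner_self_eq_norm_sq_to_K, norm_pow, pow_two]
    simp
  rw [h2] at h1
  have h3 : ‖p‖ * ‖p‖ ≤ |k|⁻¹ * β * genConst b c κ * (‖p‖ * ‖w‖) := by
    refine h1.trans ?_
    gcongr
    exacts [norm_lamOp_apply_le le_rfl p, norm_lamOp_apply_le le_rfl w]
  rcases (norm_nonneg p).eq_or_lt with h0 | h0
  · rw [← h0]
    positivity
  · refine le_of_mul_le_mul_left ?_ h0
    linarith

end

end

/-! ### The generator: continuity in time, and the relation with the stream function -/

section

open scoped InnerProductSpace

theorem abs_sqrt_one_add_sq_sub_le (x y : ℝ) :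
    |Real.sqrt (1 ^ 2 + x ^ 2) - Real.sqrt (1 ^ 2 + y ^ 2)| ≤ |x - y| := by
  have key : ∀ x y : ℝ, Real.sqrt (1 ^ 2 + x ^ 2) ≤ Real.sqrt (1 ^ 2 + y ^ 2) + |x - y| := by
    intro x y
    refine Real.sqrt_le_iff.2 ⟨by positivity, ?_⟩
    have h1 : |y| ≤ Real.sqrt (1 ^ 2 + y ^ 2) := Real.abs_le_sqrt (by linarith)
    have h2 : Real.sqrt (1 ^ 2 + y ^ 2) ^ 2 = 1 ^ 2 + y ^ 2 := Real.sq_sqrt (by positivity)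
    have h3 : y * (x - y) ≤ |y| * |x - y| := by
      rw [← abs_mul]
      exact le_abs_self _
    have h4 := mul_le_mul_of_nonneg_right h1 (abs_nonneg (x - y))
    have h5 := sq_abs (x - y)
    nlinarith
  rw [abs_le]
  have h1 := key x y
  have h2 := key y x
  rw [abs_sub_comm] at h2
  constructor <;> linarith

theorem abs_lamFun_sub_le (x y : ℝ) :
    |lamFun 1 x - lamFun 1 y| ≤ lamFun 1 y * |x - y| := by
  have hx : 0 < Real.sqrt (1 ^ 2 + x ^ 2) := by positivity
  have hy : 0 < Real.sqrt (1 ^ 2 + y ^ 2) := by positivity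
  have h : lamFun 1 x - lamFun 1 y =
      lamFun 1 y * (lamFun 1 x * (Real.sqrt (1 ^ 2 + y ^ 2) - Real.sqrt (1 ^ 2 + x ^ 2))) := by
    unfold lamFun
    field_simp
  have hy0 := lamFun_pos one_pos y
  have hx0 := lamFun_pos one_pos x
  rw [h, abs_mul, abs_mul, abs_of_pos hx0, abs_of_pos hy0, abs_sub_comm x y]
  refine mul_le_mul_of_nonneg_left ?_ hy0.le
  exact (mul_le_of_le_one_left (abs_nonneg _) (lamFun_le le_rfl x)).trans
    (abs_sqrt_one_add_sq_sub_le y x)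

theorem continuous_lamOp (k : ℝ) : Continuous (lamOp 1 k) := by
  refine LipschitzWith.continuous (K := 1) (LipschitzWith.of_dist_le_mul fun t t' => ?_)
  rw [dist_eq_norm, lamOp, lamOp, ← mulOp_sub (memLp_lamSymbol le_rfl k t)
    (memLp_lamSymbol le_rfl k t')]
  refine norm_mulOp_le ((memLp_lamSymbol le_rfl k t).sub (memLp_lamSymbol le_rfl k t'))
    (Filter.Eventually.of_forall fun ξ => ?_)
  rw [Pi.sub_apply, ← Complex.ofReal_sub, Complex.norm_real, Real.norm_eq_abs]
  refine (abs_lamFun_sub_le _ _).trans ((mul_le_of_le_one_left (abs_nonneg _)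
    (lamFun_le le_rfl _)).trans ?_)
  rw [sub_sub_sub_cancel_left, Real.dist_eq, abs_sub_comm]
  simp

theorem continuous_rieszOp (k : ℝ) : Continuous (rieszOp 1 k) := by
  refine LipschitzWith.continuous (K := 2) (LipschitzWith.of_dist_le_mul fun t t' => ?_)
  rw [dist_eq_norm, rieszOp, rieszOp, ← mulOp_sub (memLp_rieszSymbol le_rfl k t)
    (memLp_rieszSymbol le_rfl k t')]
  refine norm_mulOp_le ((memLp_rieszSymbol le_rfl k t).sub (memLp_rieszSymbol le_rfl k t'))
    (Filter.Eventually.of_forall fun ξ => ?_)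
  rw [Pi.sub_apply, ← mul_sub, norm_mul, Complex.norm_I, one_mul, ← Complex.ofReal_sub, Complex.norm_real,
    Real.norm_eq_abs]
  have hd : (2 * Real.pi * ξ / k - t) - (2 * Real.pi * ξ / k - t') = t' - t := by ring
  generalize 2 * Real.pi * ξ / k - t = x at *
  generalize 2 * Real.pi * ξ / k - t' = y at *
  have h1 := abs_lamFun_sub_le x y
  have h2 : x * lamFun 1 x - y * lamFun 1 y =
      (x - y) * lamFun 1 x + y * (lamFun 1 x - lamFun 1 y) := by ring
  have h3 := abs_mul_lamFun_le one_pos y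
  rw [abs_mul, abs_of_pos (lamFun_pos one_pos y)] at h3
  have h4 : |y * (lamFun 1 x - lamFun 1 y)| ≤ |x - y| := by
    rw [abs_mul]
    calc |y| * |lamFun 1 x - lamFun 1 y| ≤ |y| * (lamFun 1 y * |x - y|) := by gcongr
      _ = |y| * lamFun 1 y * |x - y| := by ring
      _ ≤ 1 * |x - y| := by gcongr
      _ = _ := one_mul _
  have h5 : |(x - y) * lamFun 1 x| ≤ |x - y| := by
    rw [abs_mul, abs_of_pos (lamFun_pos one_pos x)]
    exact mul_le_of_le_one_right (abs_nonneg _) (lamFun_le le_rfl x)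
  rw [h2, Real.dist_eq, abs_sub_comm t t', ← hd]
  refine (abs_add_le _ _).trans ?_
  push_cast
  linarith

section

variable {b c k t : ℝ} {G G' F F' : L2R →L[ℂ] L2R}

theorem continuous_genOp (hc : 0 < c) (hb : 0 < b) (hG : ‖G‖ ≤ b)
    (hco : ∀ v, c * ‖v‖ ^ 2 ≤ (⟪v, G v⟫_ℂ).re) : Continuous (genOp G F k) := by
  have h1 := continuous_lamOp k
  have h2 := continuous_rieszOp k
  have h3 : Continuous (ellOp G k) := by
    unfold ellOp
    exact (h1.clm_comp (continuous_const.clm_comp h1)).sub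
      (h2.clm_comp (continuous_const.clm_comp h2))
  have h4 : Continuous fun t => Ring.inverse (ellOp G k t) := by
    refine continuous_iff_continuousAt.2 fun t => ?_
    obtain ⟨u, hu⟩ := isUnit_ellOp (k := k) (t := t) hc hb hG hco
    have h5 := NormedRing.inverse_continuousAt u
    rw [hu] at h5
    exact ContinuousAt.comp (f := ellOp G k) h5 h3.continuousAt
  unfold genOp
  have h6 : Continuous fun t => lamOp 1 k t ∘L Ring.inverse G := h1.clm_comp continuous_const
  have h7 : Continuous fun _ : ℝ => F := continuous_const
  exact (h7.clm_comp (h1.clm_comp (h4.clm_comp h6))).const_smul (-(Complex.I / (k : ℂ)))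

theorem intertwine_inverse {J A B : L2R →L[ℂ] L2R} (hA : IsUnit A) (hB : IsUnit B)
    (h : ∀ v, J (A v) = B (J v)) (v : L2R) : J (Ring.inverse A v) = Ring.inverse B (J v) := by
  have h1 := h (Ring.inverse A v)
  rw [apply_inverse_of_isUnit hA] at h1
  rw [h1, inverse_apply_of_isUnit hB]

/-- The generators on `H^s` and on `L²` agree. -/
theorem mulOp_genOp {G₀ F₀ : L2R →L[ℂ] L2R} {m : ℝ → ℂ}
    (hm : MemLp m ∞ (volume : Measure ℝ)) {c₀ b₀ : ℝ} (hc : 0 < c) (hb : 0 < b) (hG : ‖G‖ ≤ b)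
    (hco : ∀ v, c * ‖v‖ ^ 2 ≤ (⟪v, G v⟫_ℂ).re) (hc₀ : 0 < c₀) (hb₀ : 0 < b₀) (hG₀ : ‖G₀‖ ≤ b₀)
    (hco₀ : ∀ v, c₀ * ‖v‖ ^ 2 ≤ (⟪v, G₀ v⟫_ℂ).re)
    (hGG : ∀ v, mulOp m (G v) = G₀ (mulOp m v)) (hFF : ∀ v, mulOp m (F v) = F₀ (mulOp m v))
    (v : L2R) : mulOp m (genOp G F k t v) = genOp G₀ F₀ k t (mulOp m v) := by
  have hl : ∀ v, mulOp m (lamOp 1 k t v) = lamOp 1 k t (mulOp m v) := fun v =>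
    mulOp_comm hm (memLp_lamSymbol le_rfl k t) v
  have hr : ∀ v, mulOp m (rieszOp 1 k t v) = rieszOp 1 k t (mulOp m v) := fun v =>
    mulOp_comm hm (memLp_rieszSymbol le_rfl k t) v
  have hi := intertwine_inverse (isUnit_of_coercive G hc hco) (isUnit_of_coercive G₀ hc₀ hco₀) hGG
  have hT : ∀ v, mulOp m (ellOp G k t v) = ellOp G₀ k t (mulOp m v) := by
    intro v
    simp only [ellOp, sub_apply, ContinuousLinearMap.comp_apply, map_sub, hl, hr, hi, hGG]
  have hTi := intertwine_inverse (isUnit_ellOp hc hb hG hco) (isUnit_ellOp hc₀ hb₀ hG₀ hco₀) hT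
  simp only [genOp, smul_apply, ContinuousLinearMap.comp_apply, map_smul, hFF, hl, hTi, hi]

/-- The right hand side of the evolution equation is the generator applied to the solution. -/
theorem fourier_eq_genOp {f g : ℝ → ℝ} (hf : MemLp f ∞ (volume : Measure ℝ))
    (hg : MemLp g ∞ (volume : Measure ℝ)) (hc : 0 < c) (hb : 0 < b)
    (hgb : ‖freqMul g‖ ≤ b) (hco : ∀ v, c * ‖v‖ ^ 2 ≤ (⟪v, freqMul g v⟫_ℂ).re)
    {w Φ V : L2R} (hΦ : IsStreamFunction g k t w Φ)
    (hV : ∀ᵐ y : ℝ, V y = Complex.I * f y / k * Φ y) :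
    (𝓕 V : L2R) = genOp (freqMul g) (freqMul f) k t (𝓕 w) := by
  obtain ⟨Φ', u, u', h1, h2, h3, h4⟩ := hΦ
  have mg := memLp_top_ofReal hg
  have fadd : ∀ a b : L2R, (𝓕 (a + b) : L2R) = 𝓕 a + 𝓕 b := FourierTransform.fourier_add
  have fsmul : ∀ (a : ℂ) (b : L2R), (𝓕 (a • b) : L2R) = a • 𝓕 b := FourierTransform.fourier_smul
  have fshift : ∀ a b : L2R, (𝓕 ((k⁻¹ : ℂ) • a - (Complex.I * t) • b) : L2R) =
      (k⁻¹ : ℂ) • 𝓕 a - (Complex.I * t) • 𝓕 b := by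
    intro a b
    rw [sub_eq_add_neg, ← neg_smul, fadd, fsmul, fsmul, neg_smul, ← sub_eq_add_neg]
  have pshift : ∀ a b : L2R, ∀ᵐ y : ℝ,
      mulOp (fun y => (g y : ℂ)) ((k⁻¹ : ℂ) • a - (Complex.I * t) • b) y =
        g y * (a y / k - Complex.I * t * b y) := by
    intro a b
    filter_upwards [coeFn_mulOp mg ((k⁻¹ : ℂ) • a - (Complex.I * t) • b),
      Lp.coeFn_sub ((k⁻¹ : ℂ) • a) ((Complex.I * t) • b), Lp.coeFn_smul (k⁻¹ : ℂ) a,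
      Lp.coeFn_smul (Complex.I * t : ℂ) b] with y e1 e2 e3 e4
    rw [e1, e2, Pi.sub_apply, e3, e4, Pi.smul_apply, Pi.smul_apply, smul_eq_mul, smul_eq_mul]
    ring
  have hu : u = mulOp (fun y => (g y : ℂ)) ((k⁻¹ : ℂ) • Φ' - (Complex.I * t) • Φ) := by
    refine Lp.ext ?_
    filter_upwards [h2, pshift Φ' Φ] with y e1 e2
    rw [e1, e2]
  have hw : Φ + w = mulOp (fun y => (g y : ℂ)) ((k⁻¹ : ℂ) • u' - (Complex.I * t) • u) := by
    refine Lp.ext ?_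
    filter_upwards [h4, pshift u' u, Lp.coeFn_add Φ w] with y e1 e2 e3
    rw [e3, Pi.add_apply, e2, ← e1]
    ring
  have hVm : V = (Complex.I / k) • mulOp (fun y => (f y : ℂ)) Φ := by
    refine Lp.ext ?_
    filter_upwards [hV, coeFn_mulOp (memLp_top_ofReal hf) Φ,
      Lp.coeFn_smul (Complex.I / k : ℂ) (mulOp (fun y => (f y : ℂ)) Φ)] with y e1 e2 e3
    rw [e1, e3, Pi.smul_apply, e2, smul_eq_mul]
    ring
  have d1 := h1.hasFreqDeriv.hasShiftDeriv (k := k) (t := t)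
  have d2 := h3.hasFreqDeriv.hasShiftDeriv (k := k) (t := t)
  rw [← fshift] at d1 d2
  have hu' : (𝓕 u : L2R) = freqMul g (𝓕 ((k⁻¹ : ℂ) • Φ' - (Complex.I * t) • Φ)) := by
    rw [freqMul_fourier, ← hu]
  have hw' : (𝓕 Φ + 𝓕 w : L2R) = freqMul g (𝓕 ((k⁻¹ : ℂ) • u' - (Complex.I * t) • u)) := by
    rw [freqMul_fourier, ← hw, fadd]
  set d := (𝓕 ((k⁻¹ : ℂ) • Φ' - (Complex.I * t) • Φ) : L2R)
  set e := (𝓕 ((k⁻¹ : ℂ) • u' - (Complex.I * t) • u) : L2R)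
  set Ψ := lamOp 1 k t (𝓕 Φ : L2R) - rieszOp 1 k t d with hΨ
  have hΦΨ : (𝓕 Φ : L2R) = lamOp 1 k t Ψ := d1.eq_lamOp
  have hd : rieszOp 1 k t Ψ = d := by
    have := hasShiftDeriv_lamOp (k := k) (t := t) le_rfl Ψ
    rw [← hΦΨ] at this
    exact this.unique d1
  have hGu := isUnit_of_coercive (freqMul g) hc hco
  have he : Ring.inverse (freqMul g) (𝓕 Φ : L2R) + Ring.inverse (freqMul g) (𝓕 w : L2R) = e := by
    rw [← map_add, hw', inverse_apply_of_isUnit hGu]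
  have hT : ellOp (freqMul g) k t Ψ = -lamOp 1 k t (Ring.inverse (freqMul g) (𝓕 w : L2R)) := by
    rw [ellOp, sub_apply]
    simp only [ContinuousLinearMap.comp_apply]
    rw [hd, ← hΦΨ, ← hu', ← d2.lamOp_eq le_rfl, ← he, map_add]
    abel
  have hΨ' : Ψ = -Ring.inverse (ellOp (freqMul g) k t)
      (lamOp 1 k t (Ring.inverse (freqMul g) (𝓕 w : L2R))) := by
    rw [← map_neg, ← hT, inverse_apply_of_isUnit (isUnit_ellOp hc hb hgb hco)]
  rw [hVm, fsmul, ← freqMul_fourier, hΦΨ, hΨ', genOp, smul_apply]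
  simp only [ContinuousLinearMap.comp_apply, map_neg, smul_neg, neg_smul]

end

end

/-! ### Propagation of regularity -/

/-- Local solvability of a linear equation, on a time interval whose length depends only on the
bound of the generator. -/
theorem exists_linear_ode_solution {X : Type*} [NormedAddCommGroup X] [NormedSpace ℝ X]
    [CompleteSpace X] {A : ℝ → X →L[ℝ] X} (hA : Continuous A) {K : NNReal}
    (hK : ∀ t, ‖A t‖₊ ≤ K) (t₀ : ℝ) (x : X) :
    ∃ α : ℝ → X, α t₀ = x ∧ ∀ t ∈ Set.Ioo (t₀ - 1 / (2 * (K + 1))) (t₀ + 1 / (2 * (K + 1))),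
      HasDerivAt α (A t (α t)) t := by
  set h : ℝ := 1 / (2 * (K + 1)) with hh
  have h0 : 0 < h := by positivity
  have hmem : t₀ ∈ Set.Icc (t₀ - h) (t₀ + h) := ⟨by linarith, by linarith⟩
  -- on the ball of radius `‖x‖` around `x` the vector field is bounded by `2 K ‖x‖`
  have hP : IsPicardLindelof (fun t v => A t v) (tmin := t₀ - h) (tmax := t₀ + h) ⟨t₀, hmem⟩ x
      ‖x‖₊ 0 (K * (2 * ‖x‖₊)) K := by
    refine ⟨fun t _ => ((A t).lipschitz.weaken (hK t)).lipschitzOnWith,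
      fun v _ => (hA.clm_apply continuous_const).continuousOn, fun t _ v hv => ?_, ?_⟩
    · have h1 : ‖v‖ ≤ 2 * ‖x‖ := by
        rw [Metric.mem_closedBall, dist_eq_norm] at hv
        have h2 := norm_le_norm_add_norm_sub' v x
        have h3 : ((‖x‖₊ : NNReal) : ℝ) = ‖x‖ := rfl
        linarith
      refine ((A t).le_of_opNorm_le (hK t) v).trans ?_
      push_cast
      exact mul_le_mul_of_nonneg_left h1 K.2
    · simp only [add_sub_cancel_left, sub_sub_cancel, max_self, NNReal.coe_mul, coe_nnnorm,
        NNReal.coe_zero, sub_zero, NNReal.coe_ofNat]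
      have hK0 : (0 : ℝ) ≤ K := K.2
      have h1 : (K : ℝ) * h * 2 ≤ 1 := by
        rw [hh]
        rw [mul_one_div, div_mul_eq_mul_div, div_le_one (by positivity)]
        linarith
      nlinarith [norm_nonneg x]
  obtain ⟨α, hα0, hα⟩ := hP.exists_eq_forall_mem_Icc_hasDerivWithinAt₀
  exact ⟨α, hα0, fun t ht => (hα t (Set.Ioo_subset_Icc_self ht)).hasDerivAt
    (Icc_mem_nhds ht.1 ht.2)⟩

/-- If `J` embeds `X` into `Y` and intertwines two bounded linear evolutions, then a solution in `Y`
with initial datum in the range of `J` is the image of a solution in `X`. -/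
theorem exists_lift_of_linear_ode {X Y : Type*} [NormedAddCommGroup X] [NormedSpace ℝ X]
    [CompleteSpace X] [NormedAddCommGroup Y] [NormedSpace ℝ Y] {A : ℝ → X →L[ℝ] X}
    {B : ℝ → Y →L[ℝ] Y} (hA : Continuous A) {K K' : NNReal} (hK : ∀ t, ‖A t‖₊ ≤ K)
    (hK' : ∀ t, ‖B t‖₊ ≤ K') {J : X →L[ℝ] Y} (hJ : Function.Injective J)
    (hJAB : ∀ t v, J (A t v) = B t (J v)) {y : ℝ → Y} (hy : ∀ t, HasDerivAt y (B t (y t)) t)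
    {x₀ : X} (hx₀ : J x₀ = y 0) :
    ∃ v : ℝ → X, (∀ t, HasDerivAt v (A t (v t)) t) ∧ ∀ t, J (v t) = y t := by
  set h : ℝ := 1 / (2 * (K + 1)) with hh
  have h0 : 0 < h := by positivity
  have hloc : ∀ t₀ x, J x = y t₀ → ∃ α : ℝ → X, (∀ t ∈ Set.Ioo (t₀ - h) (t₀ + h),
      HasDerivAt α (A t (α t)) t) ∧ ∀ t ∈ Set.Ioo (t₀ - h) (t₀ + h), J (α t) = y t := by
    intro t₀ x hx
    obtain ⟨α, hα0, hα⟩ := exists_linear_ode_solution hA hK t₀ x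
    refine ⟨α, hα, ?_⟩
    refine ODE_solution_unique_of_mem_Ioo (v := fun t y => B t y) (s := fun _ => Set.univ)
      (t₀ := t₀) (K := K')
      (fun t _ => ((B t).lipschitz.weaken (hK' t)).lipschitzOnWith)
      ⟨by linarith, by linarith⟩ (fun t ht => ⟨?_, trivial⟩) (fun t _ => ⟨hy t, trivial⟩) ?_
    · rw [← hJAB]
      exact J.hasFDerivAt.comp_hasDerivAt t (hα t ht)
    · rw [hα0, hx]
  -- the length `h` of the time interval is uniform, so that finitely many steps reach every time
  have hall : ∀ n : ℕ, ∀ t : ℝ, |t| ≤ n * (h / 2) → ∃ x, J x = y t := by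
    intro n
    induction n with
    | zero =>
      intro t ht
      have : t = 0 := by simpa using ht
      exact ⟨x₀, by rw [this, hx₀]⟩
    | succ n ih =>
      intro t ht
      have hn : (0 : ℝ) < n + 1 := by positivity
      push_cast at ht
      have h1 : |t| / (n + 1) ≤ h / 2 := by
        rw [div_le_iff₀ hn]
        linarith
      obtain ⟨x, hx⟩ := ih (t * (n / (n + 1))) (by
        rw [abs_mul, abs_of_nonneg (by positivity : (0 : ℝ) ≤ n / (n + 1))]
        calc |t| * (n / (n + 1)) = n * (|t| / (n + 1)) := by ring
          _ ≤ _ := by gcongr)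
      obtain ⟨α, -, hα⟩ := hloc _ x hx
      refine ⟨α t, hα t ?_⟩
      have h2 : t - t * (n / (n + 1)) = t / (n + 1) := by
        field_simp
        ring
      have h3 : |t - t * (n / (n + 1))| < h := by
        rw [h2, abs_div, abs_of_pos hn]
        linarith
      rw [abs_lt] at h3
      constructor <;> linarith [h3.1, h3.2]
  have hex : ∀ t, ∃ x, J x = y t := by
    intro t
    obtain ⟨n, hn⟩ := exists_nat_ge (|t| / (h / 2))
    exact hall n t ((div_le_iff₀ (by positivity)).1 hn)
  choose v hv using hex
  refine ⟨v, fun t => ?_, hv⟩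
  obtain ⟨α, hα, hαy⟩ := hloc t (v t) (hv t)
  have hmem : Set.Ioo (t - h) (t + h) ∈ nhds t := Ioo_mem_nhds (by linarith) (by linarith)
  have heq : v =ᶠ[nhds t] α := by
    filter_upwards [hmem] with τ hτ
    exact hJ (by rw [hv, hαy τ hτ])
  have h1 := (hα t (mem_of_mem_nhds hmem)).congr_of_eventuallyEq heq
  rwa [← heq.eq_of_nhds] at h1

/-! ### The weight in time -/

section

open scoped InnerProductSpace

/-- The weight `exp (C arctan x)`. -/
noncomputable def expArctan (C x : ℝ) : ℝ := Real.exp (C * Real.arctan x)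

theorem expArctan_pos (C x : ℝ) : 0 < expArctan C x := Real.exp_pos _

theorem abs_mul_arctan_le (C x : ℝ) : |C * Real.arctan x| ≤ |C| * (Real.pi / 2) := by
  rw [abs_mul]
  refine mul_le_mul_of_nonneg_left ?_ (abs_nonneg _)
  exact abs_le.2 ⟨(Real.neg_pi_div_two_lt_arctan x).le, (Real.arctan_lt_pi_div_two x).le⟩

theorem expArctan_le (C x : ℝ) : expArctan C x ≤ Real.exp (|C| * (Real.pi / 2)) :=
  Real.exp_le_exp.2 ((le_abs_self _).trans (abs_mul_arctan_le C x))

theorem le_expArctan (C x : ℝ) : Real.exp (-(|C| * (Real.pi / 2))) ≤ expArctan C x :=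
  Real.exp_le_exp.2 (neg_le_of_abs_le (abs_mul_arctan_le C x))

theorem continuous_expArctan (C : ℝ) : Continuous (expArctan C) := by
  unfold expArctan
  exact Real.continuous_exp.comp (continuous_const.mul Real.continuous_arctan)

theorem hasDerivAt_expArctan (C x : ℝ) :
    HasDerivAt (expArctan C) (C * lamFun 1 x ^ 2 * expArctan C x) x := by
  have h := ((Real.hasDerivAt_arctan x).const_mul C).exp
  have h2 : lamFun 1 x ^ 2 = 1 / (1 + x ^ 2) := by
    rw [lamFun, inv_pow, Real.sq_sqrt (by positivity), one_pow, one_div]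
  rw [h2]
  refine h.congr_deriv ?_
  rw [expArctan]
  ring

/-- A quantitative Taylor expansion, uniform in the base point. -/
theorem exists_expArctan_taylor (C : ℝ) : ∃ D, ∀ x h,
    |expArctan C (x + h) - expArctan C x - h * (C * lamFun 1 x ^ 2 * expArctan C x)| ≤
      D * h ^ 2 := by
  have hl : ∀ x, lamFun 1 x ^ 2 = (1 + x ^ 2)⁻¹ := fun x => by
    rw [lamFun, inv_pow, Real.sq_sqrt (by positivity), one_pow]
  have hd : ∀ x, HasDerivAt (fun x => C * lamFun 1 x ^ 2 * expArctan C x)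
      ((C ^ 2 - 2 * C * x) * (1 + x ^ 2)⁻¹ ^ 2 * expArctan C x) x := by
    intro x
    simp only [hl]
    have h1 : HasDerivAt (fun x : ℝ => (1 + x ^ 2)⁻¹) (-(2 * x) / (1 + x ^ 2) ^ 2) x := by
      have := ((hasDerivAt_pow 2 x).const_add 1).fun_inv (by positivity)
      simpa using this
    have h2 := (h1.const_mul C).mul (hasDerivAt_expArctan C x)
    refine h2.congr_deriv ?_
    rw [hl]
    field_simp
    ring
  set D := (C ^ 2 + |C|) * Real.exp (|C| * (Real.pi / 2)) with hD
  have hbound : ∀ x, ‖(C ^ 2 - 2 * C * x) * (1 + x ^ 2)⁻¹ ^ 2 * expArctan C x‖ ≤ D := by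
    intro x
    rw [Real.norm_eq_abs, abs_mul, abs_of_pos (expArctan_pos C x), hD]
    refine mul_le_mul ?_ (expArctan_le C x) (expArctan_pos C x).le (by positivity)
    rw [abs_mul, abs_of_nonneg (by positivity : (0 : ℝ) ≤ (1 + x ^ 2)⁻¹ ^ 2), inv_pow,
      ← div_eq_mul_inv, div_le_iff₀ (by positivity)]
    have h1 : |C ^ 2 - 2 * C * x| ≤ C ^ 2 + |C| * (1 + x ^ 2) := by
      refine (abs_sub _ _).trans ?_
      rw [abs_of_nonneg (sq_nonneg C), abs_mul, abs_mul, abs_two]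
      nlinarith [abs_nonneg C, sq_nonneg (|x| - 1), sq_abs x]
    have h2 : (1 : ℝ) ≤ 1 + x ^ 2 := by nlinarith [sq_nonneg x]
    have h3 : (1 : ℝ) + x ^ 2 ≤ (1 + x ^ 2) ^ 2 := by nlinarith [sq_nonneg x]
    have h4 : (1 : ℝ) ≤ (1 + x ^ 2) ^ 2 := h2.trans h3
    calc |C ^ 2 - 2 * C * x| ≤ C ^ 2 * 1 + |C| * (1 + x ^ 2) := by linarith
      _ ≤ C ^ 2 * (1 + x ^ 2) ^ 2 + |C| * (1 + x ^ 2) ^ 2 := by gcongr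
      _ = _ := by ring
  refine ⟨D, fun x h => ?_⟩
  have hlip : ∀ y, |C * lamFun 1 y ^ 2 * expArctan C y - C * lamFun 1 x ^ 2 * expArctan C x| ≤
      D * |y - x| := fun y =>
    convex_univ.norm_image_sub_le_of_norm_hasDerivWithin_le
      (fun z _ => (hd z).hasDerivWithinAt) (fun z _ => hbound z) (Set.mem_univ x) (Set.mem_univ y)
  have h0 : 0 ≤ D := (norm_nonneg _).trans (hbound 0)
  have key := (convex_uIcc x (x + h)).norm_image_sub_le_of_norm_hasDerivWithin_le
    (f := fun y => expArctan C y - y * (C * lamFun 1 x ^ 2 * expArctan C x)) (C := D * |h|)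
    (fun z _ => ((hasDerivAt_expArctan C z).sub
      ((hasDerivAt_id z).mul_const _)).hasDerivWithinAt) (fun z hz => by
        rw [one_mul]
        refine (hlip z).trans (mul_le_mul_of_nonneg_left ?_ h0)
        have := Set.abs_sub_left_of_mem_uIcc hz
        simpa [abs_sub_comm] using this)
    (Set.left_mem_uIcc) (Set.right_mem_uIcc)
  rw [Real.norm_eq_abs, Real.norm_eq_abs, add_sub_cancel_left, mul_assoc D, ← sq,
    sq_abs] at key
  refine le_trans (le_of_eq ?_) key
  congr 1
  ring

/-- The ratio of the weights of `H^s` for the parameters `1` and `ε`. -/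
noncomputable def weightRatio (s : ℕ) (ε ξ : ℝ) : ℝ := sobWeightSq s 1 ξ / sobWeightSq s ε ξ

/-- The weight of the energy, with respect to the norm of `H^s` with the parameter `ε`. -/
noncomputable def energyOp (s : ℕ) (ε C k t : ℝ) : L2R →L[ℂ] L2R :=
  mulOp fun ξ => (weightRatio s ε ξ * expArctan C (2 * Real.pi * ξ / k - t) : ℝ)

section

variable {s : ℕ} {ε C k t : ℝ}

theorem one_le_weightRatio (hε : 0 < ε) (hε1 : ε ≤ 1) (ξ : ℝ) : 1 ≤ weightRatio s ε ξ := by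
  rw [weightRatio, one_le_div (zero_lt_one.trans_le (one_le_sobWeightSq s ε ξ))]
  refine Finset.sum_le_sum fun j _ => ?_
  rw [one_mul, mul_pow]
  refine mul_le_of_le_one_left ?_ (pow_le_one₀ hε.le hε1)
  rw [pow_mul]
  positivity

theorem weightRatio_le (hε : 0 < ε) (hε1 : ε ≤ 1) (ξ : ℝ) :
    weightRatio s ε ξ ≤ (ε ^ (2 * s))⁻¹ := by
  rw [weightRatio, div_le_iff₀ (zero_lt_one.trans_le (one_le_sobWeightSq s ε ξ)), sobWeightSq,
    sobWeightSq, Finset.mul_sum]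
  refine Finset.sum_le_sum fun j hj => ?_
  have hj' : j ≤ s := by simpa [Nat.lt_succ_iff] using hj
  rw [one_mul, mul_pow ε, ← mul_assoc (_)⁻¹]
  have hx : 0 ≤ (2 * Real.pi * ξ) ^ (2 * j) := (even_two_mul j).pow_nonneg _
  refine le_mul_of_one_le_left hx ?_
  rw [← div_eq_inv_mul, one_le_div (by positivity)]
  exact pow_le_pow_of_le_one hε.le hε1 (by omega)

theorem continuous_weightRatio (s : ℕ) (ε : ℝ) : Continuous (weightRatio s ε) :=
  (continuous_sobWeightSq s 1).div (continuous_sobWeightSq s ε) fun ξ =>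
    (zero_lt_one.trans_le (one_le_sobWeightSq s ε ξ)).ne'

theorem energySymbol_le (hε : 0 < ε) (hε1 : ε ≤ 1) (ξ x : ℝ) :
    ‖((weightRatio s ε ξ * expArctan C x : ℝ) : ℂ)‖ ≤
      (ε ^ (2 * s))⁻¹ * Real.exp (|C| * (Real.pi / 2)) := by
  have h1 := one_le_weightRatio (s := s) hε hε1 ξ
  have h2 := expArctan_pos C x
  rw [Complex.norm_real, Real.norm_eq_abs, abs_of_pos (by positivity)]
  exact mul_le_mul (weightRatio_le hε hε1 ξ) (expArctan_le C x) h2.le (by positivity)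

theorem memLp_energySymbol (hε : 0 < ε) (hε1 : ε ≤ 1) (C k t : ℝ) :
    MemLp (fun ξ : ℝ => ((weightRatio s ε ξ * expArctan C (2 * Real.pi * ξ / k - t) : ℝ) : ℂ))
      ∞ volume := by
  have h1 := continuous_weightRatio s ε
  have h2 := continuous_expArctan C
  exact memLp_top_of_bound (Continuous.aestronglyMeasurable (by fun_prop)) _
    (Filter.Eventually.of_forall fun ξ => energySymbol_le hε hε1 ξ _)

theorem inner_energyOp (hε : 0 < ε) (hε1 : ε ≤ 1) (u v : L2R) :
    ⟪energyOp s ε C k t u, v⟫_ℂ = ⟪u, energyOp s ε C k t v⟫_ℂ := by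
  rw [energyOp, inner_mulOp_left (memLp_energySymbol hε hε1 C k t)]
  simp only [Complex.conj_ofReal]

theorem norm_energyOp_apply_le (hε : 0 < ε) (hε1 : ε ≤ 1) (v : L2R) :
    ‖energyOp s ε C k t v‖ ≤ (ε ^ (2 * s))⁻¹ * Real.exp (|C| * (Real.pi / 2)) * ‖v‖ :=
  norm_mulOp_apply_le (memLp_energySymbol hε hε1 C k t)
    (Filter.Eventually.of_forall fun ξ => energySymbol_le hε hε1 ξ _) v

theorem re_inner_energyOp_ge (hε : 0 < ε) (hε1 : ε ≤ 1) (v : L2R) :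
    Real.exp (-(|C| * (Real.pi / 2))) * ‖v‖ ^ 2 ≤ (⟪v, energyOp s ε C k t v⟫_ℂ).re := by
  obtain ⟨hi, he⟩ := re_inner_mulOp (memLp_energySymbol (s := s) hε hε1 C k t) v
  obtain ⟨hi1, he1⟩ := re_inner_mulOp (m := fun _ => 1) (memLp_top_const _) v
  have h1 : ‖v‖ ^ 2 = ∫ x, 1 * ‖v x‖ ^ 2 := by
    rw [← he1]
    simp only [Complex.ofReal_one, mulOp_one, ContinuousLinearMap.id_apply]
    exact (inner_self_eq_norm_sq (𝕜 := ℂ) v).symm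
  rw [energyOp, he, h1, ← integral_const_mul]
  refine integral_mono (hi1.const_mul _) hi fun ξ => ?_
  simp only [one_mul]
  refine mul_le_mul_of_nonneg_right ?_ (sq_nonneg _)
  have h2 := one_le_weightRatio (s := s) hε hε1 ξ
  have h3 := expArctan_pos C (2 * Real.pi * ξ / k - t)
  exact (le_expArctan C _).trans (le_mul_of_one_le_left h3.le h2)

theorem hasDerivAt_energyOp (hε : 0 < ε) (hε1 : ε ≤ 1) (C k t : ℝ) :
    HasDerivAt (energyOp s ε C k)
      (-(C : ℂ) • (lamOp 1 k t ∘L energyOp s ε C k t ∘L lamOp 1 k t)) t := by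
  obtain ⟨D, hD⟩ := exists_expArctan_taylor C
  rw [hasDerivAt_iff_isLittleO_nhds_zero]
  refine Asymptotics.IsBigO.trans_isLittleO (g := fun h : ℝ => h ^ 2) ?_
    (Asymptotics.isLittleO_pow_id one_lt_two)
  refine Asymptotics.IsBigO.of_bound ((ε ^ (2 * s))⁻¹ * D) (Filter.Eventually.of_forall fun h => ?_)
  have D0 : 0 ≤ D := by simpa using (abs_nonneg _).trans (hD 0 1)
  refine ContinuousLinearMap.opNorm_le_bound _ (by positivity) fun v => ?_
  rw [mul_comm (_ * D), mul_comm, ← mul_comm (_ * D), mul_comm ‖v‖]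
  refine Lp.norm_le_mul_norm_of_ae_le_mul ?_
  have m := memLp_energySymbol (s := s) hε hε1 C k
  have l := memLp_lamSymbol le_rfl k t
  have hlin : (energyOp s ε C k (t + h) - energyOp s ε C k t -
      h • -(C : ℂ) • (lamOp 1 k t ∘L energyOp s ε C k t ∘L lamOp 1 k t)) v =
      energyOp s ε C k (t + h) v - energyOp s ε C k t v +
        ((h * C : ℝ) : ℂ) • lamOp 1 k t (energyOp s ε C k t (lamOp 1 k t v)) := by
    simp only [sub_apply, smul_apply, ContinuousLinearMap.comp_apply]
    rw [neg_smul, smul_neg, sub_neg_eq_add, Complex.ofReal_mul, mul_smul]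
    simp only [Complex.coe_smul]
    rfl
  rw [hlin]
  filter_upwards [coeFn_mulOp (m (t + h)) v, coeFn_mulOp (m t) v, coeFn_mulOp l v,
    coeFn_mulOp (m t) (lamOp 1 k t v), coeFn_mulOp l (energyOp s ε C k t (lamOp 1 k t v)),
    Lp.coeFn_add (energyOp s ε C k (t + h) v - energyOp s ε C k t v)
      (((h * C : ℝ) : ℂ) • lamOp 1 k t (energyOp s ε C k t (lamOp 1 k t v))),
    Lp.coeFn_sub (energyOp s ε C k (t + h) v) (energyOp s ε C k t v),
    Lp.coeFn_smul ((h * C : ℝ) : ℂ) (lamOp 1 k t (energyOp s ε C k t (lamOp 1 k t v)))]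
    with ξ h1 h2 h3 h4 h5 h6 h7 h8
  rw [h6, Pi.add_apply, h7, h8, Pi.sub_apply, Pi.smul_apply, smul_eq_mul]
  erw [h1, h2, h5, h4, h3]
  set x := 2 * Real.pi * ξ / k - t with hx
  have hx' : 2 * Real.pi * ξ / k - (t + h) = x + -h := by
    rw [hx]
    ring
  rw [hx']
  have e : ((weightRatio s ε ξ * expArctan C (x + -h) : ℝ) : ℂ) * v ξ -
      ((weightRatio s ε ξ * expArctan C x : ℝ) : ℂ) * v ξ +
      ((h * C : ℝ) : ℂ) * ((lamFun 1 x : ℂ) * (((weightRatio s ε ξ * expArctan C x : ℝ) : ℂ) *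
        ((lamFun 1 x : ℂ) * v ξ))) =
      ((weightRatio s ε ξ * (expArctan C (x + -h) - expArctan C x -
        (-h) * (C * lamFun 1 x ^ 2 * expArctan C x)) : ℝ) : ℂ) * v ξ := by
    push_cast
    ring
  rw [e, norm_mul, Complex.norm_real, norm_mul, Real.norm_eq_abs, Real.norm_eq_abs,
    abs_of_pos (zero_lt_one.trans_le (one_le_weightRatio hε hε1 ξ)), Real.norm_eq_abs,
    abs_of_nonneg (sq_nonneg h)]
  refine mul_le_mul_of_nonneg_right ?_ (norm_nonneg _)
  have h9 := hD x (-h)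
  rw [neg_sq] at h9
  calc weightRatio s ε ξ * _ ≤ (ε ^ (2 * s))⁻¹ * (D * h ^ 2) :=
        mul_le_mul (weightRatio_le hε hε1 ξ) h9 (abs_nonneg _) (by positivity)
    _ = _ := by ring

/-- The derivative in time of the energy of a differentiable curve. -/
theorem hasDerivAt_energy (hε : 0 < ε) (hε1 : ε ≤ 1) {v : ℝ → L2R} {v' : L2R}
    (hv : HasDerivAt v v' t) :
    HasDerivAt (fun t => (⟪v t, energyOp s ε C k t (v t)⟫_ℂ).re)
      (-C * (⟪lamOp 1 k t (v t), energyOp s ε C k t (lamOp 1 k t (v t))⟫_ℂ).re +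
        2 * (⟪energyOp s ε C k t (v t), v'⟫_ℂ).re) t := by
  have h1 : HasDerivAt (fun t => (energyOp s ε C k t).restrictScalars ℝ)
      ((-(C : ℂ) • (lamOp 1 k t ∘L energyOp s ε C k t ∘L lamOp 1 k t)).restrictScalars ℝ) t :=
    (ContinuousLinearMap.restrictScalarsL ℂ L2R L2R ℝ ℝ).hasFDerivAt.comp_hasDerivAt t
      (hasDerivAt_energyOp hε hε1 C k t)
  have h2 := h1.clm_apply hv
  have h3 := Complex.reCLM.hasFDerivAt.comp_hasDerivAt t (hv.inner ℂ h2)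
  refine h3.congr_deriv ?_
  simp only [Complex.reCLM_apply, ContinuousLinearMap.coe_restrictScalars', inner_add_right,
    smul_apply, ContinuousLinearMap.comp_apply, inner_smul_right, Complex.add_re]
  rw [← inner_lamOp le_rfl, ← inner_energyOp hε hε1 (v t) v', ← Complex.ofReal_neg,
    Complex.re_ofReal_mul]
  have h4 : (⟪v', energyOp s ε C k t (v t)⟫_ℂ).re = (⟪energyOp s ε C k t (v t), v'⟫_ℂ).re :=
    inner_re_symm (𝕜 := ℂ) _ _
  rw [h4]
  ring

end

end

/-! ### The energy on the Fourier side -/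

section

open scoped InnerProductSpace

theorem weightedEnergy_eq_lintegral (s : ℕ) (C k t : ℝ) (u : L2R) :
    weightedEnergy s C k t u = ∫⁻ ξ : ℝ, ENNReal.ofReal (sobWeightSq s 1 ξ *
      expArctan C (2 * Real.pi * ξ / k - t)) * ‖(𝓕 u : L2R) ξ‖ₑ ^ 2 := by
  have hm : AEMeasurable (fun ξ => ‖(𝓕 u : L2R) ξ‖ₑ ^ 2) volume :=
    (Lp.aestronglyMeasurable _).enorm.pow_const 2
  have hc := continuous_expArctan C
  rw [weightedEnergy, ← lintegral_finsetSum' _ fun j _ => ?_]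
  · refine lintegral_congr fun ξ => ?_
    rw [sobWeightSq, Finset.sum_mul, ENNReal.ofReal_sum_of_nonneg, Finset.sum_mul]
    · simp only [one_mul, expArctan]
    · intro j _
      exact mul_nonneg ((even_two_mul j).pow_nonneg _) (expArctan_pos _ _).le
  · refine AEMeasurable.mul ?_ hm
    have h1 : Continuous fun ξ : ℝ => (2 * Real.pi * ξ) ^ (2 * j) *
        expArctan C (2 * Real.pi * ξ / k - t) := by fun_prop
    exact h1.measurable.ennreal_ofReal.aemeasurable

theorem hsNormSq_eq_weightedEnergy (s : ℕ) (k t : ℝ) (u : L2R) :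
    hsNormSq s u = weightedEnergy s 0 k t u := by
  simp [hsNormSq, weightedEnergy]

theorem weightedEnergy_le {C C' K : ℝ} (hK : 0 ≤ K)
    (h : ∀ x, expArctan C x ≤ K * expArctan C' x) (s : ℕ) (k t : ℝ) (u : L2R) :
    weightedEnergy s C k t u ≤ ENNReal.ofReal K * weightedEnergy s C' k t u := by
  rw [weightedEnergy_eq_lintegral, weightedEnergy_eq_lintegral,
    ← lintegral_const_mul' _ _ ENNReal.ofReal_ne_top]
  refine lintegral_mono fun ξ => ?_
  rw [← mul_assoc, ← ENNReal.ofReal_mul hK]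
  refine mul_le_mul_left (ENNReal.ofReal_le_ofReal ?_) _
  have := mul_le_mul_of_nonneg_left (h (2 * Real.pi * ξ / k - t))
    (zero_le_one.trans (one_le_sobWeightSq s 1 ξ))
  linarith

theorem hsNormSq_le_weightedEnergy (s : ℕ) (C k t : ℝ) (u : L2R) :
    hsNormSq s u ≤ ENNReal.ofReal (Real.exp (|C| * (Real.pi / 2))) * weightedEnergy s C k t u := by
  rw [hsNormSq_eq_weightedEnergy s k t]
  refine weightedEnergy_le (Real.exp_pos _).le (fun x => ?_) s k t u
  have h := mul_le_mul_of_nonneg_left (le_expArctan C x) (Real.exp_pos (|C| * (Real.pi / 2))).le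
  rw [← Real.exp_add, add_neg_cancel, Real.exp_zero] at h
  simpa [expArctan] using h

theorem weightedEnergy_le_hsNormSq (s : ℕ) (C k t : ℝ) (u : L2R) :
    weightedEnergy s C k t u ≤ ENNReal.ofReal (Real.exp (|C| * (Real.pi / 2))) * hsNormSq s u := by
  rw [hsNormSq_eq_weightedEnergy s k t]
  refine weightedEnergy_le (Real.exp_pos _).le (fun x => ?_) s k t u
  simpa [expArctan] using expArctan_le C x

theorem sobSymbol_zero (s : ℕ) (ε ξ : ℝ) :
    sobSymbol s ε 0 ξ = ((Real.sqrt (sobWeightSq s ε ξ))⁻¹ : ℝ) := by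
  simp [sobSymbol]

theorem injective_mulOp_sobSymbol (s : ℕ) (ε : ℝ) :
    Function.Injective (mulOp (sobSymbol s ε 0)) := by
  intro p q hpq
  have m := memLp_sobSymbol (Nat.zero_le s) ε
  refine Lp.ext ?_
  have h1 := coeFn_mulOp m p
  rw [hpq] at h1
  filter_upwards [h1, coeFn_mulOp m q] with x h1 h2
  rw [h1, sobSymbol_zero] at h2
  refine mul_left_cancel₀ ?_ h2
  exact_mod_cast inv_ne_zero (sqrt_sobWeightSq_pos s ε x).ne'

section

variable {s : ℕ} {ε C k t : ℝ}

theorem weightedEnergy_eq_inner (hε : 0 < ε) (hε1 : ε ≤ 1) {u v : L2R}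
    (h : mulOp (sobSymbol s ε 0) v = 𝓕 u) :
    weightedEnergy s C k t u = ENNReal.ofReal (⟪v, energyOp s ε C k t v⟫_ℂ).re := by
  obtain ⟨hi, he⟩ := re_inner_mulOp (memLp_energySymbol (s := s) hε hε1 C k t) v
  have hpos : ∀ ξ, 0 ≤ weightRatio s ε ξ * expArctan C (2 * Real.pi * ξ / k - t) := fun ξ =>
    mul_nonneg (zero_le_one.trans (one_le_weightRatio hε hε1 ξ)) (expArctan_pos _ _).le
  rw [energyOp, he, ofReal_integral_eq_lintegral_ofReal hi
    (Filter.Eventually.of_forall fun ξ => mul_nonneg (hpos ξ) (sq_nonneg _)),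
    weightedEnergy_eq_lintegral]
  have h1 := coeFn_mulOp (memLp_sobSymbol (Nat.zero_le s) ε) v
  rw [h] at h1
  refine lintegral_congr_ae ?_
  filter_upwards [h1] with ξ h1
  have hw := one_le_sobWeightSq s ε ξ
  have hp : ‖v ξ‖ ^ 2 = sobWeightSq s ε ξ * ‖(𝓕 u : L2R) ξ‖ ^ 2 := by
    rw [h1, norm_mul, mul_pow, norm_sobSymbol_sq, mul_zero, pow_zero, ← mul_assoc, mul_one_div,
      div_self (by positivity), one_mul]
  have h2 : ‖(𝓕 u : L2R) ξ‖ₑ ^ 2 = ENNReal.ofReal (‖(𝓕 u : L2R) ξ‖ ^ 2) := by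
    rw [ENNReal.ofReal_pow (norm_nonneg _), ofReal_norm]
  rw [h2, hp, ← ENNReal.ofReal_mul (mul_nonneg (zero_le_one.trans (one_le_sobWeightSq s 1 ξ))
    (expArctan_pos _ _).le), weightRatio]
  congr 1
  field_simp

/-- Elements of `H^s` are in the range of the embedding. -/
theorem exists_mulOp_sobSymbol_eq (hε : 0 < ε) (hε1 : ε ≤ 1) {u : L2R} (hu : hsNormSq s u < ∞) :
    ∃ v : L2R, mulOp (sobSymbol s ε 0) v = 𝓕 u := by
  have hcont : Continuous fun ξ : ℝ => ((Real.sqrt (sobWeightSq s ε ξ) : ℝ) : ℂ) :=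
    Complex.continuous_ofReal.comp (continuous_sobWeightSq s ε).sqrt
  have hmem : MemLp (fun ξ : ℝ => ((Real.sqrt (sobWeightSq s ε ξ) : ℝ) : ℂ) * (𝓕 u : L2R) ξ) 2
      (volume : Measure ℝ) := by
    refine ⟨hcont.aestronglyMeasurable.mul (Lp.aestronglyMeasurable _), ?_⟩
    rw [eLpNorm_lt_top_iff_lintegral_rpow_enorm_lt_top (by norm_num) (by norm_num)]
    refine lt_of_le_of_lt ?_ hu
    rw [hsNormSq_eq_weightedEnergy s 1 0, weightedEnergy_eq_lintegral]
    refine lintegral_mono fun ξ => ?_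
    have hw : sobWeightSq s ε ξ ≤ sobWeightSq s 1 ξ := by
      have := one_le_weightRatio (s := s) hε hε1 ξ
      rwa [weightRatio, one_le_div (zero_lt_one.trans_le (one_le_sobWeightSq s ε ξ))] at this
    have h2 : ‖((Real.sqrt (sobWeightSq s ε ξ) : ℝ) : ℂ)‖ₑ ^ 2 =
        ENNReal.ofReal (sobWeightSq s ε ξ) := by
      rw [← ofReal_norm, ← ENNReal.ofReal_pow (norm_nonneg _), Complex.norm_real,
        Real.norm_eq_abs, sq_abs, Real.sq_sqrt (zero_le_one.trans (one_le_sobWeightSq s ε ξ))]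
    simp only [ENNReal.toReal_ofNat, ENNReal.rpow_ofNat]
    rw [enorm_mul, mul_pow, h2]
    simp only [expArctan, zero_mul, Real.exp_zero, mul_one]
    gcongr
  refine ⟨hmem.toLp _, Lp.ext ?_⟩
  filter_upwards [coeFn_mulOp (memLp_sobSymbol (Nat.zero_le s) ε) (hmem.toLp _),
    hmem.coeFn_toLp] with ξ h1 h2
  rw [h1, h2, sobSymbol_zero, ← mul_assoc, ← Complex.ofReal_mul,
    inv_mul_cancel₀ (sqrt_sobWeightSq_pos s ε ξ).ne', Complex.ofReal_one, one_mul]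

end

/-! ### Monotonicity of the energy -/

/-- The energy of a single frequency is monotone. Both signs of `C` occur: `C > 0` controls the
future, and `C < 0` the past. -/
theorem weightedEnergy_antitone_and_monotone {s : ℕ} {ε c b β κ C k : ℝ} {f g : ℕ → ℝ → ℝ}
    (hε : 0 < ε) (hε1 : ε ≤ 1) (hc : 0 < c) (hb : 0 < b) (hg : BddChain (s + 1) b g)
    (hgc : ∀ᵐ y, c ≤ g 0 y) (hf : BddChain (s + 1) β f) (hk : k ≠ 0) (hκ : |k|⁻¹ ≤ κ)
    (hεc : ε * (2 ^ (s + 1) * b) ≤ c / 2)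
    (hsmall : 2 * (|k|⁻¹ * (2 ^ (s + 1) * β) * genConst (2 ^ (s + 1) * b) (c / 2) κ *
      ((ε ^ (2 * s))⁻¹ * Real.exp (|C| * (Real.pi / 2)))) ≤
        |C| * Real.exp (-(|C| * (Real.pi / 2))))
    {w : ℝ → L2R} (hw : ∀ t, ∃ Φ V : L2R, IsStreamFunction (g 0) k t (w t) Φ ∧
      (∀ᵐ y : ℝ, V y = Complex.I * f 0 y / k * Φ y) ∧ HasDerivAt w V t)
    (hw0 : hsNormSq s (w 0) < ∞) :
    (0 ≤ C → Antitone fun t => weightedEnergy s C k t (w t)) ∧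
      (C ≤ 0 → Monotone fun t => weightedEnergy s C k t (w t)) := by
  have hc2 : 0 < c / 2 := by positivity
  have hb2 : 0 < 2 ^ (s + 1) * b := by positivity
  have hβ : 0 ≤ β := hf.nonneg
  have hκ0 : 0 ≤ κ := (by positivity : 0 ≤ |k|⁻¹).trans hκ
  -- the coefficients as operators on `L²` and on `H^s`
  have hg0 := hg.memLp 0 (Nat.zero_le _)
  have hf0 := hf.memLp 0 (Nat.zero_le _)
  have hGp : IsMulPair b (freqMul (g 0)) (freqMul (g 1)) :=
    ⟨norm_freqMul_le hg0 (hg.bound 0 (by omega)),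
      norm_freqMul_le (hg.memLp 1 (by omega)) (hg.bound 1 (by omega)),
      fun u v h => (hg.hasWeakDeriv 0 (by omega)).freqMul_leibniz hg0 (hg.memLp 1 (by omega)) h⟩
  have hFp : IsMulPair β (freqMul (f 0)) (freqMul (f 1)) :=
    ⟨norm_freqMul_le hf0 (hf.bound 0 (by omega)),
      norm_freqMul_le (hf.memLp 1 (by omega)) (hf.bound 1 (by omega)),
      fun u v h => (hf.hasWeakDeriv 0 (by omega)).freqMul_leibniz hf0 (hf.memLp 1 (by omega)) h⟩
  have hGc := re_inner_freqMul_ge hg0 hgc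
  have hGs : IsMulPair (2 ^ (s + 1) * b) (sobMul s ε g 0) (sobMul s ε g 1) :=
    ⟨hg.norm_sobMul_le hε.le hε1 (by omega), hg.norm_sobMul_le hε.le hε1 (by omega),
      fun u v h => hg.sobMul_leibniz (by omega) h⟩
  have hFs : IsMulPair (2 ^ (s + 1) * β) (sobMul s ε f 0) (sobMul s ε f 1) :=
    ⟨hf.norm_sobMul_le hε.le hε1 (by omega), hf.norm_sobMul_le hε.le hε1 (by omega),
      fun u v h => hf.sobMul_leibniz (by omega) h⟩
  have hGsc : ∀ v, c / 2 * ‖v‖ ^ 2 ≤ (⟪v, sobMul s ε g 0 v⟫_ℂ).re := fun v =>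
    (mul_le_mul_of_nonneg_right (by linarith) (sq_nonneg _)).trans
      (hg.re_inner_sobMul_ge hε.le hε1 (by omega) hgc v)
  -- the solution, lifted to `H^s`
  obtain ⟨v₀, hv₀⟩ := exists_mulOp_sobSymbol_eq hε hε1 hw0
  have hy : ∀ t, HasDerivAt (fun t => (𝓕 (w t) : L2R))
      (genOp (freqMul (g 0)) (freqMul (f 0)) k t (𝓕 (w t))) t := by
    intro t
    obtain ⟨Φ, V, hΦ, hV, hd⟩ := hw t
    rw [← fourier_eq_genOp hf0 hg0 hc hb hGp.norm_le hGc hΦ hV]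
    exact ((Lp.fourierTransformₗᵢ ℝ ℂ).toContinuousLinearEquiv.toContinuousLinearMap.restrictScalars
      ℝ).hasFDerivAt.comp_hasDerivAt t hd
  obtain ⟨v, hv, hvw⟩ := exists_lift_of_linear_ode
    (A := fun t => (genOp (sobMul s ε g 0) (sobMul s ε f 0) k t).restrictScalars ℝ)
    (B := fun t => (genOp (freqMul (g 0)) (freqMul (f 0)) k t).restrictScalars ℝ)
    ((ContinuousLinearMap.restrictScalarsL ℂ L2R L2R ℝ ℝ).continuous.comp
      (continuous_genOp hc2 hb2 hGs.norm_le hGsc))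
    (K := Real.toNNReal (|k|⁻¹ * (2 ^ (s + 1) * β) * genConst (2 ^ (s + 1) * b) (c / 2) κ))
    (K' := Real.toNNReal (|k|⁻¹ * β * genConst b c κ))
    (fun t => by
      refine NNReal.coe_le_coe.1 ?_
      refine le_trans ?_ (Real.le_coe_toNNReal _)
      exact norm_genOp_le hGs hFs hc2 hb2 hk hκ hGsc)
    (fun t => by
      refine NNReal.coe_le_coe.1 ?_
      refine le_trans ?_ (Real.le_coe_toNNReal _)
      exact norm_genOp_le hGp hFp hc hb hk hκ hGc)
    (J := (mulOp (sobSymbol s ε 0)).restrictScalars ℝ) (injective_mulOp_sobSymbol s ε)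
    (fun t v => mulOp_genOp (memLp_sobSymbol (Nat.zero_le s) ε) hc2 hb2 hGs.norm_le hGsc hc hb
      hGp.norm_le hGc (hg.mulOp_sobMul hε.ne' (by omega)) (hf.mulOp_sobMul hε.ne' (by omega)) v)
    hy hv₀
  have hE : ∀ t, weightedEnergy s C k t (w t) =
      ENNReal.ofReal (⟪v t, energyOp s ε C k t (v t)⟫_ℂ).re := fun t =>
    weightedEnergy_eq_inner hε hε1 (hvw t)
  -- the sign of the derivative of the energy
  have hder := fun t => hasDerivAt_energy (s := s) (C := C) (k := k) hε hε1 (hv t)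
  have hbound : ∀ t, |2 * (⟪energyOp s ε C k t (v t),
      genOp (sobMul s ε g 0) (sobMul s ε f 0) k t (v t)⟫_ℂ).re| ≤
      |C| * (⟪lamOp 1 k t (v t), energyOp s ε C k t (lamOp 1 k t (v t))⟫_ℂ).re := by
    intro t
    have hgc0 := genConst_nonneg hc2 hb2 hκ0
    have h1 := norm_inner_genOp_le (t := t) hGs hFs hc2 hb2 hk hκ hGsc
      (energyOp s ε C k t (v t)) (v t)
    have h2 : lamOp 1 k t (energyOp s ε C k t (v t)) = energyOp s ε C k t (lamOp 1 k t (v t)) :=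
      mulOp_comm (memLp_lamSymbol le_rfl k t) (memLp_energySymbol hε hε1 C k t) _
    have h3 := norm_energyOp_apply_le (s := s) (C := C) (k := k) (t := t) hε hε1
      (lamOp 1 k t (v t))
    have h4 := re_inner_energyOp_ge (s := s) (C := C) (k := k) (t := t) hε hε1
      (lamOp 1 k t (v t))
    rw [h2] at h1
    rw [abs_mul, abs_two]
    set z := lamOp 1 k t (v t)
    calc _ ≤ 2 * (|k|⁻¹ * (2 ^ (s + 1) * β) * genConst (2 ^ (s + 1) * b) (c / 2) κ *
          (((ε ^ (2 * s))⁻¹ * Real.exp (|C| * (Real.pi / 2)) * ‖z‖) * ‖z‖)) := by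
          refine mul_le_mul_of_nonneg_left ((Complex.abs_re_le_norm _).trans (h1.trans ?_))
            zero_le_two
          gcongr
      _ = 2 * (|k|⁻¹ * (2 ^ (s + 1) * β) * genConst (2 ^ (s + 1) * b) (c / 2) κ *
          ((ε ^ (2 * s))⁻¹ * Real.exp (|C| * (Real.pi / 2)))) * ‖z‖ ^ 2 := by ring
      _ ≤ |C| * Real.exp (-(|C| * (Real.pi / 2))) * ‖z‖ ^ 2 :=
          mul_le_mul_of_nonneg_right hsmall (sq_nonneg _)
      _ ≤ _ := by
          rw [mul_assoc]
          exact mul_le_mul_of_nonneg_left h4 (abs_nonneg _)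
  simp only [hE]
  constructor
  · intro hC
    have h : Antitone fun t => (⟪v t, energyOp s ε C k t (v t)⟫_ℂ).re := by
      refine antitone_of_hasDerivAt_nonpos hder fun t => ?_
      have := (le_abs_self _).trans (hbound t)
      rw [abs_of_nonneg hC] at this
      simp only [ContinuousLinearMap.coe_restrictScalars', Pi.zero_apply]
      linarith
    exact fun a b hab => ENNReal.ofReal_le_ofReal (h hab)
  · intro hC
    have h : Monotone fun t => (⟪v t, energyOp s ε C k t (v t)⟫_ℂ).re := by
      refine monotone_of_hasDerivAt_nonneg hder fun t => ?_
      have := neg_le_of_abs_le (hbound t)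
      rw [abs_of_nonpos hC] at this
      simp only [ContinuousLinearMap.coe_restrictScalars', Pi.zero_apply]
      linarith
    exact fun a b hab => ENNReal.ofReal_le_ofReal (h hab)

end

/-! ### From the Sobolev norms of the coefficients to the stability theorem -/

theorem exists_bddChain {N : ℕ} {f : ℝ → ℝ} {b : ℝ} (h : sobolevInfNorm N f < ENNReal.ofReal b) :
    ∃ v : ℕ → ℝ → ℝ, v 0 = f ∧ BddChain N b v := by
  rw [sobolevInfNorm] at h
  simp only [iInf_lt_iff] at h
  obtain ⟨v, ⟨h0, hm, hw⟩, hlt⟩ := h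
  have hb : ∀ j ≤ N, eLpNorm (v j) ∞ volume < ENNReal.ofReal b := fun j hj =>
    (Finset.single_le_sum (f := fun j => eLpNorm (v j) ∞ volume) (fun _ _ => zero_le)
      (Finset.mem_range.2 (by omega))).trans_lt hlt
  have hb0 : 0 ≤ b := by
    by_contra hneg
    rw [ENNReal.ofReal_of_nonpos (by linarith)] at hlt
    exact not_lt_zero hlt
  refine ⟨v, h0, fun j hj => ⟨hm j hj, (hb j hj).trans ENNReal.ofReal_lt_top⟩, fun j hj => ?_, hw⟩
  filter_upwards [ae_le_eLpNormEssSup (f := v j) (μ := volume)] with y hy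
  rw [← eLpNorm_exponent_top] at hy
  have := hy.trans (hb j hj).le
  rwa [← ofReal_norm, ENNReal.ofReal_le_ofReal_iff hb0] at this

theorem abs_inv_torusFreq_le {L : ℝ} (hL : 0 < L) {n : ℤ} (hn : n ≠ 0) :
    torusFreq L n ≠ 0 ∧ |torusFreq L n|⁻¹ ≤ L / (2 * Real.pi) := by
  have hn' : (1 : ℝ) ≤ |(n : ℝ)| := by exact_mod_cast Int.one_le_abs hn
  have hn0 : (n : ℝ) ≠ 0 := by exact_mod_cast hn
  have hpi := Real.pi_pos
  refine ⟨by unfold torusFreq; positivity, ?_⟩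
  rw [torusFreq, abs_div, abs_mul, abs_of_pos hL, abs_of_pos (by positivity : 0 < 2 * Real.pi),
    inv_div]
  exact div_le_div_of_nonneg_left hL.le (by positivity)
    (le_mul_of_one_le_right (by positivity) hn')

theorem theorem4p1 (s : ℕ) (c M L₀ C : ℝ) (hc : 0 < c) (hL₀ : 0 < L₀) (hC : 0 < C) :
    ∃ δ > (0 : ℝ), ∃ K > (0 : ℝ), ∀ (L : ℝ) (f g : ℝ → ℝ), 0 < L → L ≤ L₀ →
      (∀ᵐ y : ℝ, c < g y ∧ g y < c⁻¹) →
      sobolevInfNorm (s + 1) g ≤ ENNReal.ofReal M →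
      ENNReal.ofReal L * sobolevInfNorm (s + 1) f ≤ ENNReal.ofReal δ →
      ∀ (ω₀ : ℤ → L2R) (W : ℝ → ℤ → L2R), IsScatteringSolution L f g W → W 0 = ω₀ →
        -- Sobolev stability
        (∀ m : ℤ, hmhsNorm L m s ω₀ < ∞ → ∀ t : ℝ,
          hmhsNorm L m s (W t) ≤ ENNReal.ofReal K * hmhsNorm L m s ω₀) ∧
        -- the weighted energy, at every single frequency
        (∀ n : ℤ, n ≠ 0 → hsNormSq s (ω₀ n) < ∞ →
          Antitone (fun t : ℝ => weightedEnergy s C (torusFreq L n) t (W t n)) ∧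
          (∀ t : ℝ, hsNormSq s (W t n) ≤
            ENNReal.ofReal K * weightedEnergy s C (torusFreq L n) t (W t n)) ∧
          weightedEnergy s C (torusFreq L n) 0 (W 0 n) ≤
            ENNReal.ofReal K * hsNormSq s (ω₀ n)) := by
  -- `b` bounds `g` and its derivatives, `κ` bounds `1 / |k|`
  set b : ℝ := |M| + 1 with hbdef
  have hb : 0 < b := by positivity
  have hpi := Real.pi_pos
  set κ : ℝ := L₀ / (2 * Real.pi) with hκdef
  have hκ0 : 0 ≤ κ := by positivity
  set ε : ℝ := min 1 (c / 2 / (2 ^ (s + 1) * b)) with hεdef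
  have hε : 0 < ε := by positivity
  have hε1 : ε ≤ 1 := min_le_left _ _
  have hεc : ε * (2 ^ (s + 1) * b) ≤ c / 2 :=
    (le_div_iff₀ (by positivity)).1 (min_le_right _ _)
  set Q : ℝ := genConst (2 ^ (s + 1) * b) (c / 2) κ *
    ((ε ^ (2 * s))⁻¹ * Real.exp (C * (Real.pi / 2))) with hQdef
  have hQ : 0 ≤ Q :=
    mul_nonneg (genConst_nonneg (by positivity) (by positivity) hκ0) (by positivity)
  set K : ℝ := Real.exp (C * (Real.pi / 2)) with hKdef
  have hK : 0 < K := Real.exp_pos _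
  have hK1 : 1 ≤ K := Real.one_le_exp (by positivity)
  set δ : ℝ := C * Real.exp (-(C * (Real.pi / 2))) / (2 ^ (s + 2) * (Q + 1)) with hδdef
  have hδ : 0 < δ := by positivity
  refine ⟨δ, hδ, K, hK, ?_⟩
  intro L f g hL hLL hg hgM hfδ ω₀ W hW h0
  subst h0
  obtain ⟨γ, hγ0, hγ⟩ : ∃ γ : ℕ → ℝ → ℝ, γ 0 = g ∧ BddChain (s + 1) b γ := by
    refine exists_bddChain (hgM.trans_lt ?_)
    rw [ENNReal.ofReal_lt_ofReal_iff hb]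
    linarith [le_abs_self M]
  -- the factor `2` leaves room, since the infimum in the norm need not be attained
  obtain ⟨φ, hφ0, hφ⟩ : ∃ φ : ℕ → ℝ → ℝ, φ 0 = f ∧ BddChain (s + 1) (2 * δ / L) φ := by
    refine exists_bddChain (lt_of_le_of_lt (b := ENNReal.ofReal (δ / L)) ?_ ?_)
    · rw [ENNReal.ofReal_div_of_pos hL]
      refine ENNReal.le_div_iff_mul_le ?_ ?_ |>.2 ?_
      · exact Or.inl (ENNReal.ofReal_pos.2 hL).ne'
      · exact Or.inl ENNReal.ofReal_ne_top
      · rwa [mul_comm]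
    · rw [ENNReal.ofReal_lt_ofReal_iff (by positivity)]
      gcongr
      linarith
  have hgc : ∀ᵐ y, c ≤ γ 0 y := by
    rw [hγ0]
    filter_upwards [hg] with y hy using hy.1.le
  have key : ∀ C' : ℝ, |C'| = C → ∀ n : ℤ, n ≠ 0 → hsNormSq s (W 0 n) < ∞ →
      (0 ≤ C' → Antitone fun t => weightedEnergy s C' (torusFreq L n) t (W t n)) ∧
      (C' ≤ 0 → Monotone fun t => weightedEnergy s C' (torusFreq L n) t (W t n)) := by
    intro C' hC' n hn hfin
    obtain ⟨hk, hkL⟩ := abs_inv_torusFreq_le hL hn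
    refine weightedEnergy_antitone_and_monotone (κ := κ) (w := fun t => W t n) hε hε1 hc hb hγ hgc
      hφ hk (hkL.trans (by rw [hκdef]; gcongr)) hεc ?_ ?_ hfin
    · rw [hC', ← hKdef]
      have h1 : |torusFreq L n|⁻¹ * (2 ^ (s + 1) * (2 * δ / L)) ≤ 2 ^ (s + 1) * δ := by
        calc |torusFreq L n|⁻¹ * (2 ^ (s + 1) * (2 * δ / L))
            ≤ L / (2 * Real.pi) * (2 ^ (s + 1) * (2 * δ / L)) := by gcongr
          _ = 2 ^ (s + 1) * δ * Real.pi⁻¹ := by field_simp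
          _ ≤ 2 ^ (s + 1) * δ * 1 := by
              gcongr
              exact inv_le_one_of_one_le₀ (by linarith [Real.pi_gt_three])
          _ = _ := mul_one _
      have h2 : 2 ^ (s + 2) * (Q + 1) * δ = C * Real.exp (-(C * (Real.pi / 2))) := by
        rw [hδdef]
        field_simp
      calc _ = 2 * (|torusFreq L n|⁻¹ * (2 ^ (s + 1) * (2 * δ / L)) * Q) := by
            rw [hQdef]
            ring
        _ ≤ 2 * (2 ^ (s + 1) * δ * (Q + 1)) := by
            gcongr
            linarith
        _ = _ := by
            rw [← h2]
            ring
    · intro t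
      obtain ⟨Φ, V, h1, h2, h3⟩ := hW.2 n hn t
      refine ⟨Φ, V, ?_, ?_, h3⟩
      · rwa [hγ0]
      · rwa [hφ0]
  have hCabs : |C| = C := abs_of_pos hC
  have hlow : ∀ C' : ℝ, |C'| = C → ∀ (n : ℤ) (t : ℝ), hsNormSq s (W t n) ≤
      ENNReal.ofReal K * weightedEnergy s C' (torusFreq L n) t (W t n) := by
    intro C' hC' n t
    have := hsNormSq_le_weightedEnergy s C' (torusFreq L n) t (W t n)
    rwa [hC'] at this
  have hup : ∀ C' : ℝ, |C'| = C → ∀ n : ℤ,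
      weightedEnergy s C' (torusFreq L n) 0 (W 0 n) ≤ ENNReal.ofReal K * hsNormSq s (W 0 n) := by
    intro C' hC' n
    have := weightedEnergy_le_hsNormSq s C' (torusFreq L n) 0 (W 0 n)
    rwa [hC'] at this
  refine ⟨fun m hm t => ?_, fun n hn hfin => ⟨(key C hCabs n hn hfin).1 hC.le,
    hlow C hCabs n, hup C hCabs n⟩⟩
  have hpos : ∀ n, 0 < (1 + torusFreq L n ^ 2) ^ m := fun n => by positivity
  have hfin : ∀ n, hsNormSq s (W 0 n) < ∞ := by
    intro n
    have h1 : ∑' n : ℤ, ENNReal.ofReal ((1 + torusFreq L n ^ 2) ^ m) * hsNormSq s (W 0 n) < ∞ := by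
      rw [hmhsNorm] at hm
      exact (ENNReal.rpow_lt_top_iff_of_pos (by norm_num)).1 hm
    have h2 := (ENNReal.le_tsum n).trans_lt h1
    by_contra h3
    rw [not_lt, top_le_iff] at h3
    rw [h3, ENNReal.mul_top (ENNReal.ofReal_pos.2 (hpos n)).ne'] at h2
    exact lt_irrefl _ h2
  have hn : ∀ n, hsNormSq s (W t n) ≤ ENNReal.ofReal (K ^ 2) * hsNormSq s (W 0 n) := by
    intro n
    rcases eq_or_ne n 0 with rfl | hn
    · rw [hW.1 t]
      refine le_mul_of_one_le_left zero_le ?_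
      rw [ENNReal.one_le_ofReal]
      exact one_le_pow₀ hK1
    · rw [ENNReal.ofReal_pow hK.le, sq, mul_assoc]
      rcases le_total 0 t with ht | ht
      · exact (hlow C hCabs n t).trans (mul_le_mul_right
          (((key C hCabs n hn (hfin n)).1 hC.le ht).trans (hup C hCabs n)) _)
      · have hCneg : |-C| = C := by rw [abs_neg, hCabs]
        exact (hlow (-C) hCneg n t).trans (mul_le_mul_right
          (((key (-C) hCneg n hn (hfin n)).2 (by linarith) ht).trans (hup (-C) hCneg n)) _)
  have hK2 : ENNReal.ofReal K = ENNReal.ofReal (K ^ 2) ^ (1 / 2 : ℝ) := by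
    rw [ENNReal.ofReal_rpow_of_nonneg (by positivity) (by norm_num), ← Real.sqrt_eq_rpow,
      Real.sqrt_sq hK.le]
  rw [hmhsNorm, hmhsNorm, hK2, ← ENNReal.mul_rpow_of_nonneg _ _ (by norm_num),
    ← ENNReal.tsum_mul_left]
  refine ENNReal.rpow_le_rpow (ENNReal.tsum_le_tsum fun n => ?_) (by norm_num)
  rw [mul_left_comm]
  exact mul_le_mul_right (hn n) _
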